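/- **Notation.** An index is a finite (possibly empty) sequence $\mathbf{k}=(k_1,\dots,k_r)$ of positive integers, and $x$ is a real number with $|x|<1$. For an index with $r=0$ or $k_r\ge 2$ put $\zeta(\mathbf{k})=\sum_{0<m_1<\cdots<m_r} m_1^{-k_1}\cdots m_r^{-k_r}$, and for any index and $N\ge1$ put $$\zeta_N^{(x)}(\mathbf{k})=\sum_{0<m_1<\cdots<m_r<N}\frac{1}{(m_1+x)^{k_1}\cdots(m_r+x)^{k_r}},\qquad \zeta_N^{(x)}(\varnothing)=1 .$$ Let $\gamma$ be Euler's constant and $\psi=\Gamma'/\Gamma$. The polynomial $Z_*^{(x)}(\mathbf{k};T)\in\mathbb{R}[T]$ is characterized by $$\zeta_N^{(x)}(\mathbf{k})=Z_*^{(x)}\bigl(\mathbf{k};\log N-\psi(1+x)\bigr)+O\bigl(N^{-1}\log^pN\bigr)\quad(N\to\infty)\ \text{ for some } p>0 .$$ Write $Z_*=Z_*^{(0)}$. Let $\mathbf{l}^\star$ be the formal sum of the $2^{s-1}$ indices $(l_1\,\square\cdots\square\, l_s)$ in which each $\square$ is a plus sign or a comma ($\varnothing^\star=\varnothing$), and put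 $Z_*^\star(\mathbf{k};T)=Z_*(\mathbf{k}^\star;T)$; functions of indices are extended linearly to formal sums. Let $*$ be the stuffle product, i.e. the bilinear product with unit $\varnothing$ and $(a,\mathbf{k})*(b,\mathbf{l})=(a,\mathbf{k}*(b,\mathbf{l}))+(b,(a,\mathbf{k})*\mathbf{l})+(a+b,\mathbf{k}*\mathbf{l})$. For non-empty indices put $\mathbf{k}\circledast\mathbf{l}=\bigl((k_1,\dots,k_{r-1})*(l_1,\dots,l_{s-1}),\,k_r+l_s\bigr)$, extended bilinearly. The Hoffman dual $\mathbf{k}^\vee$ of a non-empty index is obtained by writing $\mathbf{k}=(1\,\square\cdots\square\,1)$ with plus signs and commas and interchanging the two. The Kawashima function is $$F(\mathbf{k};x)=\sum_{m=1}^\infty(-1)^{m-1}\zeta\bigl((\underbrace{1,\dots,1}_m)\circledast(\mathbf{k}^\vee)^\star\bigr)x^m\quad(\mathbf{k}\ne\varnothing),\qquad F(\varnothing;x)=1 .$$ **Theorem.** Let $|x|<1$. The polynomials $Z_*^{(x)}(\mathbf{l};T)$ and $Z_*(\mathbf{l};T)$ exist and are unique for every index $\mathbf{l}$, and the series defining $F(\mathbf{k};x)$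 and the multiple zeta values in its coefficients converge. For every index $\mathbf{k}=(k_1,\dots,k_r)$ we have, as an identity in $\mathbb{R}[T]$, $$F(\mathbf{k};x)=\sum_{j=0}^r(-1)^{r-j}\,Z_*^\star(k_1,\dots,k_j;T)\;Z_*^{(x)}\bigl(k_r,\dots,k_{j+1};\,T-\gamma-\psi(1+x)\bigr).$$ -/

import Mathlib

open Polynomial Asymptotics Filter

noncomputable section

namespace Kawashima

/-- An index set `(k₁, …, k_r)` of positive integers; `[]` is the empty index set. -/
abbrev Index := List ℕ+

/-- Formal sums of index sets, with non-negative integer multiplicities. -/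
abbrev FormalSum := Multiset Index

/-- The stuffle (harmonic) product `k * l` of index sets. -/
def stuffle : Index → Index → FormalSum
  | [], l => {l}
  | a :: k, [] => {a :: k}
  | a :: k, b :: l =>
      (stuffle k (b :: l)).map (a :: ·) + (stuffle (a :: k) l).map (b :: ·)
        + (stuffle k l).map ((a + b) :: ·)
termination_by k l => k.length + l.length

/-- The product `k ⊛ l = ((k₁, …, k_{r-1}) * (l₁, …, l_{s-1}), k_r + l_s)` of non-empty index
sets (the value is the empty sum if `k` or `l` is empty; this case is never used). -/
def circledast (k l : Index) : FormalSum :=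
  match k.getLast?, l.getLast? with
  | some a, some b => (stuffle k.dropLast l.dropLast).map (fun w => w ++ [a + b])
  | _, _ => 0

/-- Add `a` to the first entry of an index set. -/
def addHead (a : ℕ+) : Index → Index
  | [] => [a]
  | b :: w => (a + b) :: w

/-- `l^⋆`: the formal sum of the index sets `(l₁ □ ⋯ □ l_s)`, each `□` being `+` or a comma. -/
def star : Index → FormalSum
  | [] => {[]}
  | [a] => {[a]}
  | a :: b :: l => (star (b :: l)).map (a :: ·) + (star (b :: l)).map (addHead a)

/-- Write a non-empty index set of weight `w` as `(1 □ 1 □ ⋯ □ 1)` with `w` ones; this is the list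
of the `w - 1` separators, where `true` is a comma and `false` is a plus sign. -/
def separators : Index → List Bool
  | [] => []
  | [a] => List.replicate ((a : ℕ) - 1) false
  | a :: b :: l => List.replicate ((a : ℕ) - 1) false ++ true :: separators (b :: l)

/-- The index set `(1 □ 1 □ ⋯ □ 1)` with the given separators. -/
def ofSeparators : List Bool → Index
  | [] => [1]
  | true :: s => 1 :: ofSeparators s
  | false :: s => addHead 1 (ofSeparators s)

/-- The Hoffman dual `k^∨`: commas and plus signs are interchanged in `(1 □ 1 □ ⋯ □ 1)`. -/
def hoffmanDual (k : Index) : Index :=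
  if k = [] then [] else ofSeparators ((separators k).map not)

/-- The finite sum
`ζ_N^{(x)}(k) = ∑_{0 < m₁ < ⋯ < m_r < N} 1 / ((m₁ + x)^{k₁} ⋯ (m_r + x)^{k_r})`. -/
def hurwitzSum (x : ℝ) (k : Index) (N : ℕ) : ℝ :=
  open Classical in
  ∑ m ∈ (Fintype.piFinset fun _ : Fin k.length => Finset.Ioo 0 N).filter StrictMono,
    ∏ i, 1 / ((m i : ℝ) + x) ^ (k.get i : ℕ)

/-- The term `1 / (m₁^{k₁} ⋯ m_r^{k_r})` of the multiple zeta series, for `0 < m₁ < ⋯ < m_r`. -/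
def mzvTerm (k : Index) (m : {m : Fin k.length → ℕ+ // StrictMono m}) : ℝ :=
  ∏ i, 1 / ((m.1 i : ℕ) : ℝ) ^ (k.get i : ℕ)

/-- The multiple zeta value `ζ(k) = ∑_{0 < m₁ < ⋯ < m_r} 1 / (m₁^{k₁} ⋯ m_r^{k_r})`. -/
def mzv (k : Index) : ℝ := ∑' m, mzvTerm k m

/-- The digamma function `ψ = Γ' / Γ` on the real line. -/
def digamma (s : ℝ) : ℝ := deriv Real.Gamma s / Real.Gamma s

/-- `P(log N - ψ(1+x))` describes `ζ_N^{(x)}(k)` up to `O(N⁻¹ log^p N)` as `N → ∞`. -/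
def IsStuffleReg (x : ℝ) (k : Index) (P : ℝ[X]) : Prop :=
  ∃ p : ℕ, 0 < p ∧
    (fun N : ℕ => hurwitzSum x k N - P.eval (Real.log N - digamma (1 + x)))
      =O[atTop] fun N : ℕ => (N : ℝ)⁻¹ * Real.log N ^ p

/-- The stuffle-regularized polynomial `Z_*^{(x)}(k; T)`: the polynomial characterized by
`IsStuffleReg x k`. -/
def stuffleReg (x : ℝ) (k : Index) : ℝ[X] := Classical.epsilon (IsStuffleReg x k)

/-- `Z_*^⋆(k; T) = Z_*(k^⋆; T)`, where `Z_* = Z_*^{(0)}` is extended linearly to formal sums. -/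
def stuffleRegStar (k : Index) : ℝ[X] := ((star k).map (stuffleReg 0)).sum

/-- The formal sum `(1, …, 1) ⊛ (k^∨)^⋆` with `m` ones. -/
def kawashimaSum (k : Index) (m : ℕ) : FormalSum :=
  (star (hoffmanDual k)).bind (circledast (List.replicate m 1))

/-- The term `(-1)^{m-1} ζ((1, …, 1) ⊛ (k^∨)^⋆) x^m` of the Kawashima series, with `m = n + 1`
ones and `ζ` extended linearly to formal sums. -/
def kawashimaTerm (k : Index) (x : ℝ) (n : ℕ) : ℝ :=
  (-1) ^ n * ((kawashimaSum k (n + 1)).map mzv).sum * x ^ (n + 1)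

/-- The Kawashima function `F(k; x) = ∑_{m ≥ 1} (-1)^{m-1} ζ((1, …, 1) ⊛ (k^∨)^⋆) x^m`, with the
convention `F(∅; x) = 1`. -/
def kawashimaF (k : Index) (x : ℝ) : ℝ :=
  if k = [] then 1 else ∑' n, kawashimaTerm k x n

end Kawashima

end

/-!
As a function of `y`, the Kawashima function extends to a Newton series which interpolates the
finite star sums of `k` at the natural numbers and satisfies the difference equation
`F(k, c; y) - F(k, c; y - 1) = y ^ (-c) F(k; y)`. The truncated Hurwitz sums satisfy the same kind
of equation in `N`, so a telescoping argument gives, for every `N`,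
`F(k; x) = ∑ j, (-1) ^ (r - j) F(k₁, …, k_j; x + N) ζ_{N + 1}^{(x)}(k_r, …, k_{j + 1})`.
The coefficients of the Newton series are totally monotone, hence `F(k; x + N)` differs from the
star sum `F(k; N)` by `O(N⁻¹ log ^ p N)`. Replacing the star sums and the Hurwitz sums by their
asymptotic polynomials and letting `N → ∞` shows that the right-hand side of the formula, a
polynomial in `T = log N + γ`, converges to `F(k; x)`; a polynomial converging along a sequence
that tends to infinity is constant.
-/

noncomputable section

namespace Kawashima

open scoped Topology

/-- The strictly increasing tuples `m₁ < ⋯ < m_r` with entries in `s`, the summation range of the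
finite and infinite multiple sums. -/
def strictMonoTuples {α : Type*} [LinearOrder α] (r : ℕ) (s : Finset α) : Finset (Fin r → α) :=
  open Classical in (Fintype.piFinset fun _ => s).filter StrictMono

theorem mem_strictMonoTuples {α : Type*} [LinearOrder α] {r : ℕ} {s : Finset α} {m : Fin r → α} :
    m ∈ strictMonoTuples r s ↔ (∀ i, m i ∈ s) ∧ StrictMono m := by
  simp [strictMonoTuples]

theorem strictMonoTuples_insert {α : Type*} [LinearOrder α] (r : ℕ) {a : α} {s : Finset α}
    (ha : ∀ b ∈ s, a < b) :
    strictMonoTuples (r + 1) (insert a s) = strictMonoTuples (r + 1) s ∪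
      (strictMonoTuples r s).image (Fin.cons a) := by
  ext m
  obtain ⟨b, m, rfl⟩ : ∃ b m', m = Fin.cons b m' := ⟨_, _, (Fin.cons_self_tail m).symm⟩
  simp only [mem_strictMonoTuples, Finset.mem_union, Finset.mem_image, Fin.forall_fin_succ,
    Fin.cons_zero, Fin.cons_succ, Fin.strictMono_cons, Finset.mem_insert, Fin.cons_inj]
  constructor
  · rintro ⟨⟨hb, hm⟩, hbm, hmono⟩
    have hms : ∀ i, m i ∈ s := fun i => (hm i).resolve_left <| by
      rcases hb with rfl | hb
      exacts [(hbm i).ne', ((ha b hb).trans (hbm i)).ne']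
    rcases hb with rfl | hb
    exacts [.inr ⟨m, ⟨hms, hmono⟩, rfl, rfl⟩, .inl ⟨⟨hb, hms⟩, hbm, hmono⟩]
  · rintro (⟨⟨hb, hm⟩, h⟩ | ⟨m, ⟨hm, hmono⟩, rfl, rfl⟩)
    exacts [⟨⟨.inr hb, fun i => .inr (hm i)⟩, h⟩,
      ⟨⟨.inl rfl, fun i => .inr (hm i)⟩, fun i => ha _ (hm i), hmono⟩]

/-- The multiple sum `∑ p_{i₁}^{l₁} ⋯ p_{i_r}^{l_r}` over `i₁ < ⋯ < i_r`, where the `p_i` are the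
members of the first list. -/
def nestedSum {R : Type*} [CommRing R] : List R → Index → R
  | _, [] => 1
  | [], _ :: _ => 0
  | p :: L, c :: l => nestedSum L (c :: l) + p ^ (c : ℕ) * nestedSum L l

section nestedSum

variable {R : Type*} [CommRing R]

@[simp] theorem nestedSum_nil_right (L : List R) : nestedSum L [] = 1 := by
  cases L <;> rfl

@[simp] theorem nestedSum_nil_cons (c : ℕ+) (l : Index) : nestedSum ([] : List R) (c :: l) = 0 :=
  rfl

theorem nestedSum_cons_cons (p : R) (L : List R) (c : ℕ+) (l : Index) :
    nestedSum (p :: L) (c :: l) = nestedSum L (c :: l) + p ^ (c : ℕ) * nestedSum L l :=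
  rfl

theorem sum_strictMonoTuples_toFinset {α : Type*} [LinearOrder α] (f : α → R) (k : Index)
    {L : List α} (hL : L.Pairwise (· < ·)) :
    ∑ m ∈ strictMonoTuples k.length L.toFinset, ∏ i, f (m i) ^ (k.get i : ℕ) =
      nestedSum (L.map f) k := by
  induction L generalizing k with
  | nil =>
    cases k with
    | nil =>
      simp [strictMonoTuples, Finset.filter_true_of_mem, Subsingleton.strictMono]
    | cons c k => simp [strictMonoTuples]
  | cons a L ih =>
    rw [List.pairwise_cons] at hL
    cases k with
    | nil => simp [strictMonoTuples, Finset.filter_true_of_mem, Subsingleton.strictMono]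
    | cons c k =>
      have hdisj : Disjoint (strictMonoTuples (k.length + 1) L.toFinset)
          ((strictMonoTuples k.length L.toFinset).image (Fin.cons a)) := by
        refine Finset.disjoint_left.mpr fun m hm hm' => ?_
        obtain ⟨m, -, rfl⟩ := Finset.mem_image.mp hm'
        exact (hL.1 a (by simpa using (mem_strictMonoTuples.mp hm).1 0)).false
      simp only [List.length_cons, List.toFinset_cons, List.map_cons, nestedSum_cons_cons,
        ← ih _ hL.2]
      rw [strictMonoTuples_insert _ (by simpa using hL.1), Finset.sum_union hdisj,
        Finset.sum_image (Fin.cons_right_injective (α := fun _ => α) a).injOn, Finset.mul_sum]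
      simp [Fin.prod_univ_succ]

theorem nestedSum_concat_concat (L : List R) (p : R) (l : Index) (c : ℕ+) :
    nestedSum (L ++ [p]) (l ++ [c]) = nestedSum L (l ++ [c]) + p ^ (c : ℕ) * nestedSum L l := by
  induction L generalizing l with
  | nil => rcases l with _ | ⟨a, _ | ⟨b, l⟩⟩ <;> simp [nestedSum]
  | cons q L ih =>
    cases l with
    | nil =>
      have h := ih []
      simp only [List.nil_append, nestedSum_nil_right] at h
      simp only [List.cons_append, List.nil_append, nestedSum_cons_cons, h, nestedSum_nil_right]
      ring
    | cons a l =>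
      have h := ih (a :: l)
      simp only [List.cons_append] at h ⊢
      simp only [nestedSum_cons_cons, h, ih l]
      ring

theorem nestedSum_stuffle (L : List R) (k l : Index) :
    ((stuffle k l).map (nestedSum L)).sum = nestedSum L k * nestedSum L l := by
  induction L generalizing k l with
  | nil => rcases k with _ | ⟨a, k⟩ <;> rcases l with _ | ⟨b, l⟩ <;>
      simp [stuffle, Function.comp_def]
  | cons p L ih =>
    rcases k with _ | ⟨a, k⟩
    · simp [stuffle]
    rcases l with _ | ⟨b, l⟩
    · simp [stuffle]
    have h := ih (a :: k) (b :: l)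
    simp only [stuffle, Multiset.map_add, Multiset.sum_add, Multiset.map_map, Function.comp_def,
      nestedSum_cons_cons, Multiset.sum_map_add, Multiset.sum_map_mul_left, ih, PNat.add_coe,
      pow_add] at h ⊢
    linear_combination h

theorem hasSum_pow_mul_nestedSum_replicate_one [TopologicalSpace R] [IsTopologicalRing R]
    (t : R) (L : List R) :
    HasSum (fun j => t ^ j * nestedSum L (List.replicate j 1))
      (L.map fun p => 1 + t * p).prod := by
  induction L with
  | nil =>
    have h : HasSum (fun j => t ^ j * nestedSum ([] : List R) (List.replicate j 1)) _ :=
      hasSum_single 0 fun j hj => by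
        obtain ⟨j, rfl⟩ := Nat.exists_eq_succ_of_ne_zero hj
        simp [List.replicate_succ]
    simpa using h
  | cons p L ih =>
    have hsucc (j : ℕ) : t ^ (j + 1) * nestedSum (p :: L) (List.replicate (j + 1) 1) =
        t ^ (j + 1) * nestedSum L (List.replicate (j + 1) 1) +
          t * p * (t ^ j * nestedSum L (List.replicate j 1)) := by
      rw [List.replicate_succ, nestedSum_cons_cons, PNat.one_coe]
      ring
    rw [← hasSum_nat_add_iff' 1]
    simp only [hsucc]
    convert ((hasSum_nat_add_iff' 1).mpr ih).add (ih.mul_left (t * p)) using 1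
    simp only [List.map_cons, List.prod_cons, Finset.sum_range_one, List.replicate_zero,
      nestedSum_nil_right]
    ring

end nestedSum

theorem hurwitzSum_succ_eq_nestedSum (x : ℝ) (l : Index) (N : ℕ) :
    hurwitzSum x l (N + 1) =
      nestedSum ((List.range' 1 N).map fun m : ℕ => 1 / ((m : ℝ) + x)) l := by
  have hs : (List.range' 1 N).toFinset = Finset.Ioo 0 (N + 1) := by
    ext m
    simp only [List.mem_toFinset, List.mem_range'_1, Finset.mem_Ioo]
    omega
  rw [← sum_strictMonoTuples_toFinset _ _ List.pairwise_lt_range', hs]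
  simp only [hurwitzSum, strictMonoTuples, div_pow, one_pow]

@[simp] theorem hurwitzSum_nil (x : ℝ) (N : ℕ) : hurwitzSum x [] (N + 1) = 1 := by
  rw [hurwitzSum_succ_eq_nestedSum, nestedSum_nil_right]

theorem hurwitzSum_one_of_ne_nil (x : ℝ) {l : Index} (hl : l ≠ []) : hurwitzSum x l 1 = 0 := by
  obtain ⟨c, l, rfl⟩ := List.exists_cons_of_ne_nil hl
  simpa using hurwitzSum_succ_eq_nestedSum x (c :: l) 0

theorem hurwitzSum_concat_succ (x : ℝ) (l : Index) (c : ℕ+) (N : ℕ) :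
    hurwitzSum x (l ++ [c]) (N + 2) = hurwitzSum x (l ++ [c]) (N + 1) +
      (1 / ((N : ℝ) + 1 + x)) ^ (c : ℕ) * hurwitzSum x l (N + 1) := by
  simp only [hurwitzSum_succ_eq_nestedSum]
  rw [List.range'_1_concat, List.map_append, List.map_singleton, nestedSum_concat_concat,
    add_comm 1 N, Nat.cast_succ]

theorem hurwitzSum_stuffle (x : ℝ) (k l : Index) (N : ℕ) :
    ((stuffle k l).map fun w => hurwitzSum x w (N + 1)).sum =
      hurwitzSum x k (N + 1) * hurwitzSum x l (N + 1) := by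
  simp only [hurwitzSum_succ_eq_nestedSum]
  exact nestedSum_stuffle _ k l

theorem hurwitzSum_nonneg (l : Index) (N : ℕ) : 0 ≤ hurwitzSum 0 l N :=
  Finset.sum_nonneg fun m _ => Finset.prod_nonneg fun i _ => by positivity

theorem hasSum_pow_mul_hurwitzSum_replicate_one (t : ℝ) (n : ℕ) :
    HasSum (fun j => t ^ j * hurwitzSum 0 (List.replicate j 1) (n + 1))
      (∏ i ∈ Finset.range n, (1 + t / ((i : ℝ) + 1))) := by
  simp only [hurwitzSum_succ_eq_nestedSum]
  have hprod : ∏ i ∈ Finset.range n, (1 + t / ((i : ℝ) + 1)) =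
      (((List.range' 1 n).map fun m : ℕ => 1 / ((m : ℝ) + 0)).map fun p => 1 + t * p).prod := by
    simp [List.range'_eq_map_range, Finset.prod_eq_multiset_prod, ← Multiset.coe_range,
      Function.comp_def, div_eq_mul_inv, add_comm]
  exact hprod ▸ hasSum_pow_mul_nestedSum_replicate_one t _

/-! ### Star sums and Hoffman duals, read from the last entry -/

/-- The counterpart of `addHead` for the last entry: star sums and Hoffman duals are used through
recursions on the last entry. -/
def addLast (c : ℕ+) (l : Index) : Index := (addHead c l.reverse).reverse

@[simp] theorem addLast_concat (c b : ℕ+) (l : Index) : addLast c (l ++ [b]) = l ++ [c + b] := by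
  simp [addLast, addHead]

theorem addLast_cons (c a : ℕ+) {l : Index} (hl : l ≠ []) :
    addLast c (a :: l) = a :: addLast c l := by
  obtain ⟨w, b, rfl⟩ := (List.eq_nil_or_concat' l).resolve_left hl
  rw [← List.cons_append, addLast_concat, addLast_concat, List.cons_append]

theorem addHead_ne_nil (a : ℕ+) (l : Index) : addHead a l ≠ [] := by
  cases l <;> simp [addHead]

theorem addHead_append (a : ℕ+) {l : Index} (hl : l ≠ []) (w : Index) :
    addHead a (l ++ w) = addHead a l ++ w := by
  obtain ⟨b, l, rfl⟩ := List.exists_cons_of_ne_nil hl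
  rfl

theorem addLast_addHead (c a : ℕ+) {l : Index} (hl : l ≠ []) :
    addLast c (addHead a l) = addHead a (addLast c l) := by
  obtain ⟨b, _ | ⟨d, l⟩, rfl⟩ := List.exists_cons_of_ne_nil hl
  · simp [addLast, addHead, add_left_comm]
  · simp only [addHead, addLast_cons, ne_eq, reduceCtorEq, not_false_eq_true]

theorem ne_nil_of_mem_star {v l : Index} (hv : v ≠ []) (hl : l ∈ star v) : l ≠ [] := by
  match v with
  | [a] => simp_all [star]
  | a :: b :: v =>
    simp only [star, Multiset.mem_add, Multiset.mem_map] at hl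
    rcases hl with ⟨w, _, rfl⟩ | ⟨w, _, rfl⟩
    exacts [List.cons_ne_nil _ _, addHead_ne_nil a w]

theorem star_concat {v : Index} (hv : v ≠ []) (c : ℕ+) :
    star (v ++ [c]) = (star v).map (· ++ [c]) + (star v).map (addLast c) := by
  match v with
  | [a] => simp [star, addLast, addHead, add_comm]
  | a :: b :: v =>
    have hne : ∀ l ∈ star (b :: v), l ≠ [] := fun l => ne_nil_of_mem_star (List.cons_ne_nil _ _)
    have ih := star_concat (List.cons_ne_nil b v) c
    simp only [List.cons_append, star] at ih ⊢
    rw [ih]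
    simp only [Multiset.map_add, Multiset.map_map, Function.comp_def, List.cons_append]
    rw [Multiset.map_congr rfl fun l hl => addHead_append a (hne l hl) [c],
      Multiset.map_congr rfl fun l hl => addLast_cons c a (hne l hl),
      Multiset.map_congr rfl fun l hl => addLast_addHead c a (hne l hl)]
    abel

theorem ofSeparators_ne_nil (s : List Bool) : ofSeparators s ≠ [] := by
  rcases s with _ | ⟨_ | _, s⟩
  exacts [List.cons_ne_nil _ _, addHead_ne_nil 1 _, List.cons_ne_nil _ _]

theorem ofSeparators_concat_true (s : List Bool) :
    ofSeparators (s ++ [true]) = ofSeparators s ++ [1] := by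
  induction s with
  | nil => rfl
  | cons b s ih =>
    cases b
    · simp only [List.cons_append, ofSeparators, ih, addHead_append 1 (ofSeparators_ne_nil s)]
    · simp only [List.cons_append, ofSeparators, ih]

theorem ofSeparators_concat_false (s : List Bool) :
    ofSeparators (s ++ [false]) = addLast 1 (ofSeparators s) := by
  induction s with
  | nil => rfl
  | cons b s ih =>
    cases b
    · simp only [List.cons_append, ofSeparators, ih, addLast_addHead _ _ (ofSeparators_ne_nil s)]
    · simp only [List.cons_append, ofSeparators, ih, addLast_cons _ _ (ofSeparators_ne_nil s)]

theorem separators_concat_one {k : Index} (hk : k ≠ []) :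
    separators (k ++ [1]) = separators k ++ [true] := by
  match k with
  | [a] => simp [separators]
  | a :: b :: k =>
    have ih := separators_concat_one (List.cons_ne_nil b k)
    simp only [List.cons_append, separators] at ih ⊢
    rw [ih, List.append_assoc, List.cons_append]

theorem separators_concat_one_add (k : Index) (c : ℕ+) :
    separators (k ++ [1 + c]) = separators (k ++ [c]) ++ [false] := by
  have hc : List.replicate (((1 + c : ℕ+) : ℕ) - 1) false =
      List.replicate ((c : ℕ) - 1) false ++ [false] := by
    rw [← List.replicate_succ', PNat.add_coe, PNat.one_coe, Nat.sub_add_cancel c.pos,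
      Nat.add_sub_cancel_left]
  match k with
  | [] => simpa only [List.nil_append, separators] using hc
  | [a] =>
    simp only [List.cons_append, List.nil_append, separators, hc]
    rw [List.append_assoc, List.cons_append]
  | a :: b :: k =>
    have ih := separators_concat_one_add (b :: k) c
    simp only [List.cons_append, separators] at ih ⊢
    rw [ih, List.append_assoc, List.cons_append]

theorem hoffmanDual_ne_nil {k : Index} (hk : k ≠ []) : hoffmanDual k ≠ [] := by
  simpa [hoffmanDual, hk] using ofSeparators_ne_nil _

theorem hoffmanDual_singleton_one : hoffmanDual [1] = [1] := by
  simp [hoffmanDual, separators, ofSeparators]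

theorem hoffmanDual_concat_one {k : Index} (hk : k ≠ []) :
    hoffmanDual (k ++ [1]) = addLast 1 (hoffmanDual k) := by
  simp [hoffmanDual, hk, separators_concat_one hk, ofSeparators_concat_false]

theorem hoffmanDual_concat_one_add (k : Index) (c : ℕ+) :
    hoffmanDual (k ++ [1 + c]) = hoffmanDual (k ++ [c]) ++ [1] := by
  simp [hoffmanDual, separators_concat_one_add, ofSeparators_concat_true]

/-- The finite star sum `∑_{0 < m₁ ≤ ⋯ ≤ m_r ≤ n} 1 / (m₁^{v₁} ⋯ m_r^{v_r})`, in which `n` itself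
is allowed. -/
def starSum (v : Index) (n : ℕ) : ℝ := ((star v).map fun l => hurwitzSum 0 l (n + 1)).sum

@[simp] theorem starSum_nil (n : ℕ) : starSum [] n = 1 := by
  simp [starSum, star]

theorem starSum_zero {v : Index} (hv : v ≠ []) : starSum v 0 = 0 := by
  refine Multiset.sum_eq_zero fun y hy => ?_
  obtain ⟨l, hl, rfl⟩ := Multiset.mem_map.mp hy
  exact hurwitzSum_one_of_ne_nil 0 (ne_nil_of_mem_star hv hl)

theorem hurwitzSum_addLast_succ {l : Index} (hl : l ≠ []) (c : ℕ+) (n : ℕ) :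
    hurwitzSum 0 (addLast c l) (n + 2) = hurwitzSum 0 (addLast c l) (n + 1) +
      (1 / ((n : ℝ) + 1)) ^ (c : ℕ) * (hurwitzSum 0 l (n + 2) - hurwitzSum 0 l (n + 1)) := by
  obtain ⟨w, b, rfl⟩ := (List.eq_nil_or_concat' l).resolve_left hl
  rw [addLast_concat, hurwitzSum_concat_succ, hurwitzSum_concat_succ, add_zero, PNat.add_coe]
  ring

theorem starSum_concat_succ (v : Index) (c : ℕ+) (n : ℕ) :
    starSum (v ++ [c]) (n + 1) =
      starSum (v ++ [c]) n + (1 / ((n : ℝ) + 1)) ^ (c : ℕ) * starSum v (n + 1) := by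
  rcases eq_or_ne v [] with rfl | hv
  · simpa [starSum, star] using hurwitzSum_concat_succ 0 [] c n
  · have hlast : (star v).map (fun l => hurwitzSum 0 (addLast c l) (n + 2)) = _ :=
      Multiset.map_congr rfl fun l hl => hurwitzSum_addLast_succ (ne_nil_of_mem_star hv hl) c n
    simp only [starSum, star_concat hv, Multiset.map_add, Multiset.sum_add, Multiset.map_map,
      Function.comp_def, hlast, hurwitzSum_concat_succ, add_zero, Multiset.sum_map_add,
      Multiset.sum_map_mul_left, Multiset.sum_map_sub]
    ring

/-! ### Sequences of order `N^{-s}` up to powers of the logarithm -/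

/-- `f N = O(N^{-s} log^p N)` for some `p`; this is the scale on which all error terms are
measured. -/
def LogO (s : ℕ) (f : ℕ → ℝ) : Prop :=
  ∃ p : ℕ, f =O[atTop] fun N : ℕ => (N : ℝ)⁻¹ ^ s * Real.log N ^ p

theorem eventually_le_log_natCast (a : ℝ) : ∀ᶠ N : ℕ in atTop, a ≤ Real.log N :=
  (Real.tendsto_log_atTop.comp tendsto_natCast_atTop_atTop).eventually_ge_atTop a

theorem isBigO_inv_pow_mul_log_pow {s t p q : ℕ} (hs : t ≤ s) (hp : p ≤ q) :
    (fun N : ℕ => (N : ℝ)⁻¹ ^ s * Real.log N ^ p) =O[atTop]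
      fun N : ℕ => (N : ℝ)⁻¹ ^ t * Real.log N ^ q := by
  refine IsBigO.of_bound' ?_
  filter_upwards [eventually_le_log_natCast 1, eventually_ge_atTop 1] with N hlog hN
  have hinv : (N : ℝ)⁻¹ ≤ 1 := inv_le_one_of_one_le₀ (by exact_mod_cast hN)
  have : 0 ≤ Real.log N := zero_le_one.trans hlog
  rw [Real.norm_of_nonneg (by positivity), Real.norm_of_nonneg (by positivity)]
  exact mul_le_mul (pow_le_pow_of_le_one (by positivity) hinv hs) (pow_le_pow_right₀ hlog hp)
    (by positivity) (by positivity)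

namespace LogO

variable {s t : ℕ} {f g : ℕ → ℝ}

theorem mono (hf : LogO s f) (h : t ≤ s) : LogO t f := by
  obtain ⟨p, hp⟩ := hf
  exact ⟨p, hp.trans (isBigO_inv_pow_mul_log_pow h le_rfl)⟩

theorem add (hf : LogO s f) (hg : LogO s g) : LogO s fun N => f N + g N := by
  obtain ⟨p, hp⟩ := hf
  obtain ⟨q, hq⟩ := hg
  exact ⟨max p q, (hp.trans (isBigO_inv_pow_mul_log_pow le_rfl (le_max_left p q))).add
    (hq.trans (isBigO_inv_pow_mul_log_pow le_rfl (le_max_right p q)))⟩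

theorem mul (hf : LogO s f) (hg : LogO t g) : LogO (s + t) fun N => f N * g N := by
  obtain ⟨p, hp⟩ := hf
  obtain ⟨q, hq⟩ := hg
  refine ⟨p + q, (hp.mul hq).congr_right fun N => ?_⟩
  rw [pow_add, pow_add]
  ring

theorem of_isBigO (hg : LogO s g) (h : f =O[atTop] g) : LogO s f := by
  obtain ⟨p, hp⟩ := hg
  exact ⟨p, h.trans hp⟩

theorem congr' (hf : LogO s f) (h : f =ᶠ[atTop] g) : LogO s g :=
  hf.of_isBigO h.symm.isBigO

theorem const (c : ℝ) : LogO 0 fun _ => c :=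
  ⟨0, by simpa using isBigO_const_const c (one_ne_zero (α := ℝ)) (atTop : Filter ℕ)⟩

theorem log : LogO 0 fun N => Real.log N := ⟨1, by simpa using isBigO_refl _ _⟩

theorem inv : LogO 1 fun N => (N : ℝ)⁻¹ := ⟨0, by simpa using isBigO_refl _ _⟩

theorem zero (s : ℕ) : LogO s fun _ => 0 := ⟨0, isBigO_zero _ _⟩

theorem const_mul (c : ℝ) (hf : LogO s f) : LogO s fun N => c * f N := by
  simpa using (const c).mul hf

theorem sub (hf : LogO s f) (hg : LogO s g) : LogO s fun N => f N - g N := by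
  simpa [sub_eq_add_neg] using hf.add (hg.const_mul (-1))

theorem pow (hf : LogO s f) (n : ℕ) : LogO (s * n) fun N => f N ^ n := by
  induction n with
  | zero => simpa using const 1
  | succ n ih => simpa [pow_succ, mul_add] using ih.mul hf

theorem multiset_sum {ι : Type*} (S : Multiset ι) {F : ι → ℕ → ℝ} (h : ∀ i ∈ S, LogO s (F i)) :
    LogO s fun N => (S.map fun i => F i N).sum := by
  induction S using Multiset.induction_on with
  | empty => simpa using zero s
  | cons i S ih =>
    simp only [Multiset.map_cons, Multiset.sum_cons]
    exact (h i (Multiset.mem_cons_self i S)).add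
      (ih fun j hj => h j (Multiset.mem_cons_of_mem hj))

theorem sum {ι : Type*} (S : Finset ι) {F : ι → ℕ → ℝ} (h : ∀ i ∈ S, LogO s (F i)) :
    LogO s fun N => ∑ i ∈ S, F i N :=
  multiset_sum S.val h

theorem eval (P : ℝ[X]) (hf : LogO 0 f) : LogO 0 fun N => P.eval (f N) := by
  simp only [eval_eq_sum_range]
  exact sum _ fun i _ => by simpa using (hf.pow i).const_mul (P.coeff i)

theorem comp_succ (hf : LogO s f) : LogO s fun N => f (N + 1) := by
  obtain ⟨p, hp⟩ := hf
  refine ⟨p, (hp.comp_tendsto (tendsto_add_atTop_nat 1)).trans (IsBigO.of_bound (2 ^ p) ?_)⟩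
  filter_upwards [eventually_ge_atTop 2] with N hN
  have hN : (2 : ℝ) ≤ N := by exact_mod_cast hN
  have hlog : Real.log (N + 1) ≤ 2 * Real.log N := by
    rw [← Nat.cast_two, ← Real.log_pow]
    exact Real.log_le_log (by positivity) (by nlinarith)
  have : 0 ≤ Real.log N := Real.log_natCast_nonneg N
  have : 0 ≤ Real.log (N + 1) := Real.log_nonneg (by linarith)
  simp only [Function.comp_apply, Nat.cast_succ]
  rw [Real.norm_of_nonneg (by positivity), Real.norm_of_nonneg (by positivity)]
  calc ((N : ℝ) + 1)⁻¹ ^ s * Real.log (N + 1) ^ p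
      ≤ (N : ℝ)⁻¹ ^ s * (2 * Real.log N) ^ p := by gcongr; linarith
    _ = 2 ^ p * ((N : ℝ)⁻¹ ^ s * Real.log N ^ p) := by ring

theorem isBigO_rpow (hf : LogO s f) {ε : ℝ} (hε : 0 < ε) :
    f =O[atTop] fun N : ℕ => (N : ℝ) ^ (ε - s) := by
  obtain ⟨p, hp⟩ := hf
  have hlog : (fun N : ℕ => Real.log N ^ p) =O[atTop] fun N : ℕ => (N : ℝ) ^ ε := by
    simpa [Function.comp_def] using
      ((isLittleO_log_rpow_rpow_atTop p hε).comp_tendsto tendsto_natCast_atTop_atTop).isBigO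
  refine (hp.trans ((isBigO_refl _ _).mul hlog)).congr' EventuallyEq.rfl ?_
  filter_upwards [eventually_gt_atTop 0] with N hN
  rw [Real.rpow_sub (by exact_mod_cast hN), Real.rpow_natCast, inv_pow, div_eq_inv_mul]

theorem tendsto_zero (hf : LogO 1 f) : Tendsto f atTop (𝓝 0) :=
  (hf.isBigO_rpow one_half_pos).trans_tendsto <| by
    simpa [Function.comp_def] using
      (tendsto_rpow_neg_atTop (by norm_num : (0 : ℝ) < 1 - 1 / 2)).comp tendsto_natCast_atTop_atTop

theorem summable (hf : LogO 2 f) : Summable f :=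
  summable_of_isBigO_nat (Real.summable_nat_rpow.mpr (by norm_num)) (hf.isBigO_rpow one_half_pos)

end LogO

theorem summable_and_abs_sum_range_sub_tsum_le {f g : ℕ → ℝ} {M : ℕ} (hg : ∀ m, M ≤ m → 0 ≤ g m)
    (hf : ∀ m, M ≤ m → |f m| ≤ g m - g (m + 1)) :
    Summable f ∧ ∀ N, M ≤ N → |∑ m ∈ Finset.range N, f m - ∑' m, f m| ≤ g N := by
  have hpartial : ∀ N, M ≤ N → ∀ n, ∑ i ∈ Finset.range n, |f (i + N)| ≤ g N := by
    intro N hN n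
    calc ∑ i ∈ Finset.range n, |f (i + N)|
        ≤ ∑ i ∈ Finset.range n, (g (i + N) - g (i + 1 + N)) :=
          Finset.sum_le_sum fun i _ => (hf (i + N) (by omega)).trans_eq (by rw [add_right_comm])
      _ = g N - g (n + N) := by rw [Finset.sum_range_sub' (fun i => g (i + N)), zero_add]
      _ ≤ g N := sub_le_self _ (hg _ (by omega))
  have hsum : Summable f := (summable_nat_add_iff M).mp <| Summable.of_abs <|
    summable_of_sum_range_le (fun _ => abs_nonneg _) (hpartial M le_rfl)
  refine ⟨hsum, fun N hN => ?_⟩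
  rw [← hsum.sum_add_tsum_nat_add N, sub_add_cancel_left, abs_neg]
  have hnorm : |∑' i, f (i + N)| ≤ ∑' i, |f (i + N)| := by
    simpa only [Real.norm_eq_abs] using
      norm_tsum_le_tsum_norm ((summable_nat_add_iff N).mpr hsum).norm
  exact hnorm.trans (Real.tsum_le_of_sum_range_le (fun _ => abs_nonneg _) (hpartial N hN))

theorem eventually_inv_sq_mul_log_pow_le (p : ℕ) : ∀ᶠ m : ℕ in atTop,
    (m : ℝ)⁻¹ ^ 2 * Real.log m ^ p ≤
      8 * (Real.log m ^ p / m - Real.log (m + 1) ^ p / (m + 1)) := by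
  filter_upwards [eventually_le_log_natCast (2 * p), eventually_ge_atTop 1] with m hlog hm
  have hm : (1 : ℝ) ≤ m := by exact_mod_cast hm
  have hderiv : ∀ x : ℝ, 0 < x → HasDerivAt (fun x => Real.log x ^ p / x)
      ((p * Real.log x ^ (p - 1) - Real.log x ^ p) / x ^ 2) x := fun x hx => by
    refine (((Real.hasDerivAt_log hx.ne').pow p).div (hasDerivAt_id' x) hx.ne').congr_deriv ?_
    rw [inv_mul_cancel_right₀ hx.ne', mul_one, Pi.pow_apply]
  obtain ⟨ξ, ⟨hmξ, hξm⟩, hξ⟩ := exists_hasDerivAt_eq_slope (fun x : ℝ => Real.log x ^ p / x) _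
    (lt_add_one (m : ℝ))
    (fun x hx => (hderiv x (by linarith [hx.1])).continuousAt.continuousWithinAt)
    (fun x hx => hderiv x (by linarith [hx.1]))
  have hlogξ : Real.log m ≤ Real.log ξ := Real.log_le_log (by linarith) hmξ.le
  have hlog0 : 0 ≤ Real.log m := Real.log_natCast_nonneg m
  have hhalf : 2 * (p * Real.log ξ ^ (p - 1)) ≤ Real.log ξ ^ p := by
    rcases p with _ | p
    · simp
    · rw [← mul_assoc, pow_succ', Nat.add_sub_cancel]
      exact mul_le_mul_of_nonneg_right (hlog.trans hlogξ) (pow_nonneg (hlog0.trans hlogξ) p)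
  have hξ0 : 0 < ξ := by linarith
  have hpow : Real.log m ^ p ≤ Real.log ξ ^ p := by gcongr
  have hpow0 : 0 ≤ Real.log ξ ^ p := pow_nonneg (hlog0.trans hlogξ) p
  rw [add_sub_cancel_left, div_one] at hξ
  rw [inv_pow, inv_mul_eq_div, ← neg_sub, ← hξ, ← neg_div, neg_sub, mul_div_assoc',
    div_le_div_iff₀ (by positivity) (by positivity)]
  have hξ2 : ξ ^ 2 ≤ 4 * (m : ℝ) ^ 2 := by nlinarith
  calc Real.log m ^ p * ξ ^ 2 ≤ Real.log ξ ^ p * (4 * (m : ℝ) ^ 2) := by gcongr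
    _ ≤ _ := by nlinarith [sq_nonneg (m : ℝ)]

/-- Comparison with the telescoping series of the differences of `log^p m / m`. -/
theorem LogO.exists_sum_range_sub {f : ℕ → ℝ} (hf : LogO 2 f) :
    ∃ C, LogO 1 fun N => ∑ m ∈ Finset.range N, f m - C := by
  obtain ⟨p, hp⟩ := hf
  obtain ⟨K, hK0, hK⟩ := hp.exists_pos
  obtain ⟨M, hM⟩ := eventually_atTop.mp (hK.bound.and (eventually_inv_sq_mul_log_pow_le p))
  have hg0 : ∀ N : ℕ, 0 ≤ K * 8 * (Real.log N ^ p / N) := fun N => by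
    have := Real.log_natCast_nonneg N
    positivity
  have hbound : ∀ m, M ≤ m → |f m| ≤
      K * 8 * (Real.log m ^ p / m) - K * 8 * (Real.log (m + 1 : ℕ) ^ p / (m + 1 : ℕ)) := by
    intro m hm
    have := Real.log_natCast_nonneg m
    have hfm := (hM m hm).1
    rw [Real.norm_eq_abs, Real.norm_of_nonneg (by positivity)] at hfm
    rw [← mul_sub, mul_assoc, Nat.cast_succ]
    exact hfm.trans (mul_le_mul_of_nonneg_left (hM m hm).2 hK0.le)
  refine ⟨∑' m, f m, p, IsBigO.of_bound (K * 8) ?_⟩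
  filter_upwards [eventually_ge_atTop M] with N hN
  have := Real.log_natCast_nonneg N
  rw [Real.norm_of_nonneg (by positivity : 0 ≤ (N : ℝ)⁻¹ ^ 1 * Real.log N ^ p), pow_one,
    inv_mul_eq_div]
  exact (summable_and_abs_sum_range_sub_tsum_le (fun m _ => hg0 m) hbound).2 N hN

theorem logO_log_succ_sub_log_sub_inv :
    LogO 2 fun m : ℕ => Real.log (m + 1 : ℕ) - Real.log m - (m : ℝ)⁻¹ := by
  refine (LogO.inv.pow 2).of_isBigO (IsBigO.of_bound 2 ?_)
  filter_upwards [eventually_ge_atTop 2] with m hm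
  have hm : (2 : ℝ) ≤ m := by exact_mod_cast hm
  have hinv : (m : ℝ)⁻¹ ≤ 1 / 2 := by
    rw [one_div]
    gcongr
  have habs : |-(m : ℝ)⁻¹| = (m : ℝ)⁻¹ := by rw [abs_neg, abs_of_pos (by positivity)]
  have hlog : Real.log (m + 1 : ℕ) - Real.log m = Real.log (1 - -(m : ℝ)⁻¹) := by
    rw [← Real.log_div (by positivity) (by positivity), Nat.cast_succ]
    congr 1
    field_simp
    ring
  have htaylor := Real.abs_log_sub_add_sum_range_le (x := -(m : ℝ)⁻¹) (by linarith) 1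
  simp only [Finset.sum_range_one, zero_add, pow_one, Nat.cast_zero, div_one, habs] at htaylor
  rw [hlog, sub_eq_neg_add, Real.norm_eq_abs, Real.norm_of_nonneg (by positivity)]
  refine htaylor.trans ?_
  rw [div_le_iff₀ (by linarith)]
  nlinarith [sq_nonneg (m : ℝ)⁻¹]

theorem logO_eval_add_sub (Q : ℝ[X]) {u h : ℕ → ℝ} (hu : LogO 0 u) (hh : LogO 1 h) :
    LogO 2 fun N => Q.eval (u N + h N) - Q.eval (u N) - Q.derivative.eval (u N) * h N := by
  have htaylor : ∀ N, Q.eval (u N + h N) - Q.eval (u N) - Q.derivative.eval (u N) * h N =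
      ∑ i ∈ Finset.range Q.natDegree, (hasseDeriv (i + 2) Q).eval (u N) * h N ^ (i + 2) := by
    intro N
    have hdeg : (taylor (u N) Q).natDegree < Q.natDegree + 2 := by rw [natDegree_taylor]; omega
    rw [add_comm (u N), ← taylor_eval, eval_eq_sum_range' hdeg, Finset.sum_range_succ',
      Finset.sum_range_succ']
    simp only [taylor_coeff, zero_add, hasseDeriv_zero', hasseDeriv_one, pow_zero, pow_one, mul_one]
    ring
  simp only [htaylor]
  refine LogO.sum _ fun i _ => ?_
  simpa using ((LogO.eval (hasseDeriv (i + 2) Q) hu).mul (hh.pow (i + 2))).mono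
    (by omega : 2 ≤ 0 + 1 * (i + 2))

theorem exists_derivative_eq (P : ℝ[X]) : ∃ Q : ℝ[X], Q.derivative = P := by
  induction P using Polynomial.induction_on' with
  | add P Q hP hQ =>
    obtain ⟨P', rfl⟩ := hP
    obtain ⟨Q', rfl⟩ := hQ
    exact ⟨P' + Q', derivative_add⟩
  | monomial n a =>
    refine ⟨monomial (n + 1) (a / (n + 1)), ?_⟩
    rw [derivative_monomial, Nat.add_sub_cancel, Nat.cast_succ, div_mul_cancel₀ _ (by positivity)]

/-! ### The regularized polynomials -/

theorem LogO.exists_sub_const_of_succ_sub {g : ℕ → ℝ} (hg : LogO 2 fun N => g (N + 1) - g N) :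
    ∃ C, LogO 1 fun N => g N - C := by
  obtain ⟨C, hC⟩ := hg.exists_sum_range_sub
  refine ⟨g 0 + C, ?_⟩
  simpa only [Finset.sum_range_sub, sub_sub] using hC

theorem LogO.of_sub_eval_log {h : ℕ → ℝ} {P : ℝ[X]}
    (hP : LogO 1 fun N => h N - P.eval (Real.log N)) : LogO 0 h := by
  simpa only [sub_add_cancel] using (hP.mono zero_le_one).add (LogO.log.eval P)

theorem logO_one_div_add (x : ℝ) : LogO 1 fun m : ℕ => 1 / ((m : ℝ) + x) := by
  refine LogO.inv.of_isBigO (IsBigO.of_bound 2 ?_)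
  filter_upwards [tendsto_natCast_atTop_atTop.eventually_ge_atTop (2 * |x| + 1)] with m hm
  have hm0 : (0 : ℝ) < m := by linarith [abs_nonneg x]
  have hmx : (m : ℝ) / 2 ≤ m + x := by linarith [neg_abs_le x]
  rw [Real.norm_of_nonneg (one_div_nonneg.mpr (by linarith)), Real.norm_of_nonneg (by positivity)]
  calc 1 / ((m : ℝ) + x) ≤ 1 / (m / 2) := one_div_le_one_div_of_le (by positivity) hmx
    _ = 2 * (m : ℝ)⁻¹ := by rw [one_div_div, div_eq_mul_inv]

theorem logO_one_div_add_sub_inv (x : ℝ) : LogO 2 fun m : ℕ => 1 / ((m : ℝ) + x) - (m : ℝ)⁻¹ := by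
  refine (((logO_one_div_add x).mul LogO.inv).const_mul (-x)).congr' ?_
  filter_upwards [eventually_gt_atTop 0,
    tendsto_natCast_atTop_atTop.eventually_gt_atTop (-x)] with m hm hmx
  have hm0 : (m : ℝ) ≠ 0 := by exact_mod_cast hm.ne'
  have hmx0 : (m : ℝ) + x ≠ 0 := by linarith
  field_simp
  ring

theorem logO_eval_log_succ_sub (Q : ℝ[X]) : LogO 2 fun m : ℕ =>
    Q.eval (Real.log (m + 1 : ℕ)) - Q.eval (Real.log m) -
      Q.derivative.eval (Real.log m) * (m : ℝ)⁻¹ := by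
  have hh : LogO 1 fun m : ℕ => Real.log (m + 1 : ℕ) - Real.log m := by
    simpa only [sub_add_cancel] using
      (logO_log_succ_sub_log_sub_inv.mono one_le_two).add LogO.inv
  have hfirst := (LogO.log.eval Q.derivative).mul logO_log_succ_sub_log_sub_inv
  rw [zero_add] at hfirst
  refine ((logO_eval_add_sub Q LogO.log hh).add hfirst).congr' (Eventually.of_forall fun m => ?_)
  simp only [add_sub_cancel]
  ring

theorem exists_logO_pow_mul_sub_eval_log_succ (x : ℝ) {c : ℕ} (hc : c ≠ 0) {h : ℕ → ℝ} {P : ℝ[X]}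
    (hP : LogO 1 fun N => h N - P.eval (Real.log N)) :
    ∃ Q : ℝ[X], LogO 2 fun m : ℕ => (1 / ((m : ℝ) + x)) ^ c * h m -
      (Q.eval (Real.log (m + 1 : ℕ)) - Q.eval (Real.log m)) := by
  rcases eq_or_ne c 1 with rfl | hc1
  · obtain ⟨Q, rfl⟩ := exists_derivative_eq P
    refine ⟨Q, ((((logO_one_div_add_sub_inv x).mul hP.of_sub_eval_log).add
      (hP.mul LogO.inv)).sub (logO_eval_log_succ_sub Q)).congr' (Eventually.of_forall fun m => ?_)⟩
    ring
  · refine ⟨0, ?_⟩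
    simpa using (((logO_one_div_add x).pow c).mul hP.of_sub_eval_log).mono
      (by omega : 2 ≤ 1 * c + 0)

theorem exists_logO_hurwitzSum_sub (x : ℝ) (l : Index) :
    ∃ P : ℝ[X], LogO 1 fun N => hurwitzSum x l N - P.eval (Real.log N) := by
  induction l using List.reverseRecOn with
  | nil =>
    refine ⟨1, (LogO.zero 1).congr' ?_⟩
    filter_upwards [eventually_gt_atTop 0] with N hN
    obtain ⟨N, rfl⟩ := Nat.exists_eq_add_of_le' hN
    rw [hurwitzSum_nil, eval_one, sub_self]
  | append_singleton l c ih =>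
    obtain ⟨P, hP⟩ := ih
    obtain ⟨Q, hQ⟩ := exists_logO_pow_mul_sub_eval_log_succ x c.ne_zero hP
    have hstep : LogO 2 fun N => (hurwitzSum x (l ++ [c]) (N + 1) - Q.eval (Real.log (N + 1 : ℕ))) -
        (hurwitzSum x (l ++ [c]) N - Q.eval (Real.log N)) := by
      refine hQ.congr' ?_
      filter_upwards [eventually_gt_atTop 0] with N hN
      obtain ⟨N, rfl⟩ := Nat.exists_eq_add_of_le' hN
      rw [hurwitzSum_concat_succ, Nat.cast_succ]
      ring
    obtain ⟨C, hC⟩ := LogO.exists_sub_const_of_succ_sub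
      (g := fun N => hurwitzSum x (l ++ [c]) N - Q.eval (Real.log N)) hstep
    exact ⟨Q + Polynomial.C C, by simpa only [eval_add, eval_C, sub_sub] using hC⟩

theorem eq_C_of_tendsto_eval {P : ℝ[X]} {u : ℕ → ℝ} {c : ℝ} (hu : Tendsto u atTop atTop)
    (h : Tendsto (fun N => P.eval (u N)) atTop (𝓝 c)) : P = C c := by
  by_cases hdeg : 0 < P.degree
  · exact absurd h.abs (not_tendsto_nhds_of_tendsto_atTop ((P.abs_tendsto_atTop hdeg).comp hu) _)
  · obtain ⟨a, rfl⟩ : ∃ a, P = C a := ⟨_, eq_C_of_degree_le_zero (not_lt.mp hdeg)⟩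
    simp only [eval_C] at h
    rw [tendsto_nhds_unique h tendsto_const_nhds]

theorem isStuffleReg_iff (x : ℝ) (l : Index) (P : ℝ[X]) :
    IsStuffleReg x l P ↔
      LogO 1 fun N => hurwitzSum x l N - P.eval (Real.log N - digamma (1 + x)) := by
  simp only [IsStuffleReg, LogO, pow_one]
  constructor
  · rintro ⟨p, _, h⟩
    exact ⟨p, h⟩
  · rintro ⟨p, h⟩
    refine ⟨p + 1, p.succ_pos, h.trans ?_⟩
    simpa using isBigO_inv_pow_mul_log_pow (s := 1) le_rfl p.le_succ

theorem tendsto_log_natCast_sub_atTop (d : ℝ) :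
    Tendsto (fun N : ℕ => Real.log N - d) atTop atTop := by
  simpa only [sub_eq_add_neg, Function.comp_def] using tendsto_atTop_add_const_right atTop (-d)
    (Real.tendsto_log_atTop.comp tendsto_natCast_atTop_atTop)

theorem existsUnique_isStuffleReg (x : ℝ) (l : Index) : ∃! P : ℝ[X], IsStuffleReg x l P := by
  obtain ⟨P, hP⟩ := exists_logO_hurwitzSum_sub x l
  refine existsUnique_of_exists_of_unique
    ⟨P.comp (X + C (digamma (1 + x))), ?_⟩ fun P Q hP hQ => ?_
  · rw [isStuffleReg_iff]
    simpa using hP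
  · rw [isStuffleReg_iff] at hP hQ
    have hlim : Tendsto (fun N : ℕ => (P - Q).eval (Real.log N - digamma (1 + x))) atTop (𝓝 0) := by
      refine (hQ.sub hP).tendsto_zero.congr fun N => ?_
      rw [eval_sub]
      ring
    simpa [sub_eq_zero] using eq_C_of_tendsto_eval (tendsto_log_natCast_sub_atTop _) hlim

theorem logO_hurwitzSum_sub_stuffleReg (x : ℝ) (l : Index) :
    LogO 1 fun N => hurwitzSum x l N - (stuffleReg x l).eval (Real.log N - digamma (1 + x)) :=
  (isStuffleReg_iff x l _).mp (Classical.epsilon_spec (existsUnique_isStuffleReg x l).exists)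

theorem logO_hurwitzSum (x : ℝ) (l : Index) : LogO 0 (hurwitzSum x l) :=
  (exists_logO_hurwitzSum_sub x l).elim fun _ hP => hP.of_sub_eval_log

theorem digamma_one : digamma 1 = -Real.eulerMascheroniConstant := by
  rw [digamma, Real.Gamma_one, div_one, Real.hasDerivAt_Gamma_one.deriv]

theorem logO_starSum_sub_stuffleRegStar (k : Index) :
    LogO 1 fun n => starSum k n -
      (stuffleRegStar k).eval (Real.log (n + 1 : ℕ) + Real.eulerMascheroniConstant) := by
  have hsum := LogO.multiset_sum (star k) fun l _ =>
    (logO_hurwitzSum_sub_stuffleReg 0 l).comp_succ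
  simp only [add_zero, digamma_one, sub_neg_eq_add, Multiset.sum_map_sub] at hsum
  simpa only [starSum, stuffleRegStar, ← coe_evalRingHom, map_multiset_sum, Multiset.map_map,
    Function.comp_def] using hsum

/-! ### Newton series -/

theorem factorial_mul_multichoose (w : ℝ) (n : ℕ) :
    (n.factorial : ℝ) * Ring.multichoose w n = ∏ i ∈ Finset.range n, (w + i) := by
  rw [← nsmul_eq_mul, Ring.factorial_nsmul_multichoose_eq_ascPochhammer,
    ascPochhammer_smeval_eq_eval]
  induction n with
  | zero => simp
  | succ n ih => rw [ascPochhammer_succ_eval, ih, Finset.prod_range_succ]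

theorem succ_mul_multichoose_succ (w : ℝ) (n : ℕ) :
    ((n : ℝ) + 1) * Ring.multichoose w (n + 1) = (w + n) * Ring.multichoose w n := by
  have hn : (n.factorial : ℝ) ≠ 0 := by positivity
  apply mul_left_cancel₀ hn
  calc (n.factorial : ℝ) * ((n + 1) * Ring.multichoose w (n + 1))
      = (n + 1).factorial * Ring.multichoose w (n + 1) := by
        rw [Nat.factorial_succ, Nat.cast_mul, Nat.cast_succ]
        ring
    _ = n.factorial * Ring.multichoose w n * (w + n) := by
        rw [factorial_mul_multichoose, factorial_mul_multichoose, Finset.prod_range_succ]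
    _ = n.factorial * ((w + n) * Ring.multichoose w n) := by ring

theorem succ_mul_multichoose_succ_eq_mul_multichoose_add_one (w : ℝ) (n : ℕ) :
    ((n : ℝ) + 1) * Ring.multichoose w (n + 1) = w * Ring.multichoose (w + 1) n := by
  linear_combination succ_mul_multichoose_succ (w + 1) n -
    ((n : ℝ) + 1) * Ring.multichoose_succ_succ w n

/-- Up to the factor `(n + 1) n^{-w}`, `multichoose w (n + 1)` is the inverse of the sequence in
Euler's limit formula for `Γ(w)`. -/
theorem isBigO_multichoose_succ (w : ℝ) :
    (fun n => Ring.multichoose w (n + 1)) =O[atTop] fun n : ℕ => (n : ℝ) ^ (w - 1) := by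
  have hmultichoose : ∀ n : ℕ, 0 < n →
      Ring.multichoose w (n + 1) = (n : ℝ) ^ w / ((n : ℝ) + 1) * (Real.GammaSeq w n)⁻¹ := by
    intro n hn
    have : 0 < (n : ℝ) ^ w := by positivity
    have : (0 : ℝ) < n.factorial := by positivity
    rw [Real.GammaSeq, ← factorial_mul_multichoose, Nat.factorial_succ]
    push_cast
    field_simp
  have hGamma : (fun n => (Real.GammaSeq w n)⁻¹) =O[atTop] fun _ => (1 : ℝ) := by
    by_cases hw : ∃ m : ℕ, w = -m
    · obtain ⟨m, rfl⟩ := hw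
      refine IsBigO.congr' (isBigO_zero _ _) ?_ EventuallyEq.rfl
      filter_upwards [eventually_ge_atTop m] with n hn
      rw [Real.GammaSeq, Finset.prod_eq_zero (Finset.mem_range_succ_iff.mpr hn)
        (neg_add_cancel _), div_zero, inv_zero]
    · push Not at hw
      exact ((Real.GammaSeq_tendsto_Gamma w).inv₀ (Real.Gamma_ne_zero hw)).isBigO_one ℝ
  have hpow : (fun n : ℕ => (n : ℝ) ^ w / ((n : ℝ) + 1)) =O[atTop]
      fun n : ℕ => (n : ℝ) ^ (w - 1) := by
    refine IsBigO.of_bound' ?_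
    filter_upwards [eventually_gt_atTop 0] with n hn
    have hn : (0 : ℝ) < n := by exact_mod_cast hn
    rw [Real.norm_of_nonneg (by positivity), Real.norm_of_nonneg (by positivity),
      Real.rpow_sub_one hn.ne']
    gcongr
    linarith
  refine IsBigO.congr' (hpow.mul hGamma) ?_ (Eventually.of_forall fun n => mul_one _)
  filter_upwards [eventually_gt_atTop 0] with n hn
  exact (hmultichoose n hn).symm

theorem summable_multichoose {w : ℝ} (hw : w < 0) : Summable fun n => Ring.multichoose w n :=
  (summable_nat_add_iff 1).mp <| summable_of_isBigO_nat
    (Real.summable_nat_rpow.mpr (by linarith)) (isBigO_multichoose_succ w)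

theorem LogO.summable_multichoose_succ_mul {a : ℕ → ℝ} (ha : LogO 1 a) {w : ℝ} (hw : w < 1) :
    Summable fun n => Ring.multichoose w (n + 1) * a n := by
  have hε : 0 < (1 - w) / 2 := by linarith
  refine summable_of_isBigO_nat (Real.summable_nat_rpow.mpr (by linarith : -1 - (1 - w) / 2 < -1))
    (((isBigO_multichoose_succ w).mul (ha.isBigO_rpow hε)).congr' EventuallyEq.rfl ?_)
  filter_upwards [eventually_gt_atTop 0] with n hn
  rw [← Real.rpow_add (by exact_mod_cast hn), Nat.cast_one]
  congr 1
  ring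

theorem LogO.summable_multichoose_mul {a : ℕ → ℝ} (ha : LogO 1 a) {w : ℝ} (hw : w < 1) :
    Summable fun n => Ring.multichoose w n * a n := by
  refine (summable_nat_add_iff 1).mp ?_
  exact ha.comp_succ.summable_multichoose_succ_mul hw

/-- The Newton series `∑_{n ≥ 0} (-1)^n a_n binom(y, n + 1)` with coefficients `a`; the signed
binomial coefficient `(-1)^n binom(y, n)` is written as `multichoose (-y) n`. -/
def newton (a : ℕ → ℝ) (y : ℝ) : ℝ := -∑' n, Ring.multichoose (-y) (n + 1) * a n

/-- The Newton series of the difference `newton a y - newton a (y - 1)`. -/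
def newtonDiff (a : ℕ → ℝ) (y : ℝ) : ℝ := ∑' n, Ring.multichoose (1 - y) n * a n

@[simp] theorem newton_zero (a : ℕ → ℝ) : newton a 0 = 0 := by
  simp [newton]

theorem newton_sub_newton {a : ℕ → ℝ} (ha : LogO 1 a) {y : ℝ} (hy : 0 < y) :
    newton a y - newton a (y - 1) = newtonDiff a y := by
  have hsum := ha.summable_multichoose_succ_mul (by linarith : -y < 1)
  have hsum' := ha.summable_multichoose_succ_mul (by linarith : 1 - y < 1)
  rw [newton, newton, newtonDiff, sub_neg_eq_add, neg_add_eq_sub, neg_sub, ← hsum'.tsum_sub hsum]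
  refine tsum_congr fun n => ?_
  rw [← neg_add_eq_sub y 1, Ring.multichoose_succ_succ]
  ring

theorem mul_newtonDiff_of_succ_mul {a b : ℕ → ℝ} (h : ∀ n : ℕ, ((n : ℝ) + 1) * b n = a n) (y : ℝ) :
    y * newtonDiff b y = newton a y := by
  rw [newton, newtonDiff, ← tsum_mul_left, ← tsum_neg]
  refine tsum_congr fun n => ?_
  rw [← h, ← neg_add_eq_sub y 1]
  linear_combination b n * succ_mul_multichoose_succ_eq_mul_multichoose_add_one (-y) n

/-- Abel summation, as `y * multichoose (1 - y) n` is `n + 1` times the difference of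
`multichoose (1 - y)` at `n` and `n + 1`. -/
theorem mul_sum_range_multichoose_of_average {a b : ℕ → ℝ}
    (h : ∀ n : ℕ, ((n : ℝ) + 1) * b n = ∑ i ∈ Finset.range (n + 1), a i) (y : ℝ) (M : ℕ) :
    y * ∑ n ∈ Finset.range M, Ring.multichoose (1 - y) n * b n =
      ∑ n ∈ Finset.range M, Ring.multichoose (1 - y) n * a n -
        Ring.multichoose (1 - y) M * ∑ i ∈ Finset.range M, a i := by
  induction M with
  | zero => simp
  | succ M ih =>
    rw [← h, Finset.sum_range_succ, mul_add, ih, Finset.sum_range_succ]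
    have hM := h M
    rw [Finset.sum_range_succ] at hM
    linear_combination Ring.multichoose (1 - y) M * hM +
      b M * succ_mul_multichoose_succ (1 - y) M

theorem mul_newtonDiff_of_average {a b : ℕ → ℝ} (ha : LogO 1 a) (hb : LogO 1 b)
    (h : ∀ n : ℕ, ((n : ℝ) + 1) * b n = ∑ i ∈ Finset.range (n + 1), a i) {y : ℝ} (hy : 0 < y) :
    y * newtonDiff b y = newtonDiff a y := by
  have hboundary : Tendsto
      (fun M => Ring.multichoose (1 - y) M * ∑ i ∈ Finset.range M, a i) atTop (𝓝 0) := by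
    rw [← tendsto_add_atTop_iff_nat 1]
    have hsucc : (fun n : ℕ => (n : ℝ) + 1) =O[atTop] fun n : ℕ => (n : ℝ) := by
      refine IsBigO.of_bound 2 ?_
      filter_upwards [eventually_ge_atTop 1] with n hn
      have hn : (1 : ℝ) ≤ n := by exact_mod_cast hn
      rw [Real.norm_of_nonneg (by positivity), Real.norm_of_nonneg (by positivity)]
      linarith
    have hbigO := (isBigO_multichoose_succ (1 - y)).mul
      (hsucc.mul (hb.isBigO_rpow (half_pos hy)))
    simp only [h] at hbigO
    have hlim : Tendsto (fun n : ℕ => (n : ℝ) ^ (-(y / 2))) atTop (𝓝 0) :=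
      (tendsto_rpow_neg_atTop (half_pos hy)).comp tendsto_natCast_atTop_atTop
    refine (hbigO.congr' EventuallyEq.rfl ?_).trans_tendsto hlim
    filter_upwards [eventually_gt_atTop 0] with n hn
    have hn : (0 : ℝ) < n := by exact_mod_cast hn
    rw [← Real.rpow_one_add' hn.le (by push_cast; linarith), ← Real.rpow_add hn, Nat.cast_one]
    congr 1
    ring
  have hy1 : 1 - y < 1 := by linarith
  have hlimb := (hb.summable_multichoose_mul hy1).hasSum.tendsto_sum_nat.const_mul y
  have hlima := (ha.summable_multichoose_mul hy1).hasSum.tendsto_sum_nat.sub hboundary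
  rw [sub_zero] at hlima
  simp only [mul_sum_range_multichoose_of_average h] at hlimb
  exact tendsto_nhds_unique hlimb hlima

/-! ### Totally monotone sequences -/

/-- Iterated differences `(-1)^N Δ^N a`, i.e. `bdiff a (N + 1) p = bdiff a N p - bdiff a N (p + 1)`;
this sign makes them non-negative for a totally monotone sequence. -/
def bdiff (a : ℕ → ℝ) : ℕ → ℕ → ℝ
  | 0 => a
  | N + 1 => fun p => bdiff a N p - bdiff a N (p + 1)

/-- A totally (or completely) monotone sequence. -/
def TotallyMonotone (a : ℕ → ℝ) : Prop := ∀ N p, 0 ≤ bdiff a N p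

theorem bdiff_zero (a : ℕ → ℝ) (p : ℕ) : bdiff a 0 p = a p := rfl

theorem bdiff_succ (a : ℕ → ℝ) (N p : ℕ) :
    bdiff a (N + 1) p = bdiff a N p - bdiff a N (p + 1) := rfl

namespace TotallyMonotone

variable {a b : ℕ → ℝ}

theorem antitone (ha : TotallyMonotone a) (N : ℕ) : Antitone (bdiff a N) :=
  antitone_nat_of_succ_le fun p => sub_nonneg.mp (ha (N + 1) p)

theorem bdiff_le (ha : TotallyMonotone a) (N p : ℕ) : bdiff a N p ≤ a p := by
  induction N with
  | zero => exact le_rfl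
  | succ N ih =>
    rw [bdiff_succ]
    linarith [ha N (p + 1)]

theorem of_succ_mul (ha : TotallyMonotone a) (h : ∀ n : ℕ, ((n : ℝ) + 1) * b n = a n) :
    TotallyMonotone b := by
  have hrec : ∀ N p : ℕ, bdiff a (N + 1) p =
      ((p : ℝ) + N + 2) * bdiff b (N + 1) p - (N + 1) * bdiff b N p := by
    intro N
    induction N with
    | zero =>
      intro p
      simp only [bdiff_succ, bdiff_zero, ← h]
      push_cast
      ring
    | succ N ih =>
      intro p
      rw [bdiff_succ, ih, ih, bdiff_succ b (N + 1), bdiff_succ b N]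
      push_cast
      ring
  intro N
  induction N with
  | zero =>
    intro p
    have hp := ha 0 p
    rw [bdiff_zero, ← h] at hp
    exact nonneg_of_mul_nonneg_right hp (by positivity)
  | succ N ih =>
    intro p
    have hp := ha (N + 1) p
    rw [hrec] at hp
    have hN : 0 ≤ ((N : ℝ) + 1) * bdiff b N p := mul_nonneg (by positivity) (ih p)
    exact nonneg_of_mul_nonneg_right (hN.trans (sub_nonneg.mp hp)) (by positivity)

theorem of_average (ha : TotallyMonotone a)
    (h : ∀ n : ℕ, ((n : ℝ) + 1) * b n = ∑ i ∈ Finset.range (n + 1), a i) : TotallyMonotone b := by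
  have hrec : ∀ N : ℕ, bdiff a N 0 = ((N : ℝ) + 1) * bdiff b N 0 ∧ ∀ p : ℕ,
      bdiff a N (p + 1) = ((p : ℝ) + N + 2) * bdiff b N (p + 1) - (p + 1) * bdiff b N p := by
    intro N
    induction N with
    | zero =>
      refine ⟨by simpa [bdiff_zero] using (h 0).symm, fun p => ?_⟩
      have hp := h (p + 1)
      rw [Finset.sum_range_succ, ← h p] at hp
      simp only [bdiff_zero]
      push_cast at hp ⊢
      linear_combination -hp
    | succ N ih =>
      obtain ⟨ih0, ih⟩ := ih
      refine ⟨?_, fun p => ?_⟩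
      · rw [bdiff_succ, ih0, ih, bdiff_succ b]
        push_cast
        ring
      · rw [bdiff_succ, ih, ih, bdiff_succ b, bdiff_succ b]
        push_cast
        ring
  intro N p
  induction p with
  | zero =>
    have hN := ha N 0
    rw [(hrec N).1] at hN
    exact nonneg_of_mul_nonneg_right hN (by positivity)
  | succ p ih =>
    have hN := ha N (p + 1)
    rw [(hrec N).2] at hN
    have hp : 0 ≤ ((p : ℝ) + 1) * bdiff b N p := mul_nonneg (by positivity) ih
    exact nonneg_of_mul_nonneg_right (hp.trans (sub_nonneg.mp hN)) (by positivity)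

theorem logO_bdiff (hm : TotallyMonotone a) (ha : LogO 1 a) (N : ℕ) : LogO 1 (bdiff a N) :=
  ha.of_isBigO <| IsBigO.of_norm_le fun n => by
    rw [Real.norm_of_nonneg (hm N n)]
    exact hm.bdiff_le N n

end TotallyMonotone

theorem newton_add_one {a : ℕ → ℝ} (ha : LogO 1 a) {y : ℝ} (hy : -1 < y) :
    newton a (y + 1) = a 0 + newton (bdiff a 1) y := by
  have hdiff := newton_sub_newton ha (by linarith : 0 < y + 1)
  have hy1 : -y < 1 := by linarith
  have hsum := ha.summable_multichoose_mul hy1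
  have hsum_succ := ha.summable_multichoose_succ_mul hy1
  rw [add_sub_cancel_right, newtonDiff, sub_add_cancel_right, hsum.tsum_eq_zero_add,
    Ring.multichoose_zero_right, one_mul] at hdiff
  have hbdiff : newton (bdiff a 1) y =
      newton a y + ∑' n, Ring.multichoose (-y) (n + 1) * a (n + 1) := by
    rw [newton, newton, neg_add_eq_sub,
      ← ((summable_nat_add_iff 1).mpr hsum).tsum_sub hsum_succ, ← tsum_neg]
    refine tsum_congr fun n => ?_
    rw [bdiff_succ, bdiff_zero, bdiff_zero]
    ring
  linear_combination hdiff - hbdiff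

theorem newton_add_natCast {a : ℕ → ℝ} (hm : TotallyMonotone a) (ha : LogO 1 a) {y : ℝ}
    (hy : -1 < y) (N : ℕ) :
    newton a (y + N) = ∑ i ∈ Finset.range N, bdiff a i 0 + newton (bdiff a N) y := by
  induction N generalizing y with
  | zero => simp [bdiff]
  | succ N ih =>
    rw [Nat.cast_succ, add_comm (N : ℝ), ← add_assoc, ih (by linarith),
      newton_add_one (hm.logO_bdiff ha N) hy, Finset.sum_range_succ, add_assoc]
    rfl

theorem newton_natCast {a : ℕ → ℝ} (hm : TotallyMonotone a) (ha : LogO 1 a) (N : ℕ) :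
    newton a N = ∑ i ∈ Finset.range N, bdiff a i 0 := by
  simpa using newton_add_natCast hm ha neg_one_lt_zero N

theorem abs_newton_bdiff_le {a : ℕ → ℝ} (hm : TotallyMonotone a) {y : ℝ} (hy : 0 < y) (N : ℕ) :
    |newton (bdiff a N) y| ≤ (∑' n, |Ring.multichoose (-y) (n + 1)|) * bdiff a N 0 := by
  have hsum : Summable fun n => |Ring.multichoose (-y) (n + 1)| :=
    ((summable_nat_add_iff 1).mpr (summable_multichoose (by linarith))).abs
  have hle : ∀ n, ‖Ring.multichoose (-y) (n + 1) * bdiff a N n‖ ≤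
      |Ring.multichoose (-y) (n + 1)| * bdiff a N 0 := by
    intro n
    rw [norm_mul, Real.norm_eq_abs, Real.norm_of_nonneg (hm N n)]
    exact mul_le_mul_of_nonneg_left (hm.antitone N n.zero_le) (abs_nonneg _)
  rw [newton, abs_neg, ← Real.norm_eq_abs, ← tsum_mul_right]
  exact tsum_of_norm_bounded (hsum.mul_right _).hasSum hle

theorem newton_add_succ_sub_isBigO {a : ℕ → ℝ} (hm : TotallyMonotone a) (ha : LogO 1 a)
    {x : ℝ} (hx : -1 < x) :
    (fun N : ℕ => newton a (x + (N + 1 : ℕ)) - newton a (N + 1 : ℕ)) =O[atTop]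
      fun N : ℕ => newton a (N + 1 : ℕ) - newton a N := by
  refine IsBigO.of_bound (∑' n, |Ring.multichoose (-(x + 1)) (n + 1)| + 1)
    (Eventually.of_forall fun N => ?_)
  have hshift : newton a (x + (N + 1 : ℕ)) =
      ∑ i ∈ Finset.range N, bdiff a i 0 + newton (bdiff a N) (x + 1) := by
    rw [← newton_add_natCast hm ha (by linarith : -1 < x + 1), Nat.cast_succ, add_comm (N : ℝ),
      add_assoc]
  rw [hshift, newton_natCast hm ha, newton_natCast hm ha, Finset.sum_range_succ,
    add_sub_add_left_eq_sub, add_sub_cancel_left, Real.norm_of_nonneg (hm N 0), add_mul, one_mul]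
  refine (norm_sub_le _ _).trans ?_
  rw [Real.norm_of_nonneg (hm N 0)]
  gcongr
  exact abs_newton_bdiff_le hm (by linarith) N

/-! ### The Kawashima function as a Newton series -/

/-- The coefficients of the Newton series of the Kawashima function `F(k; ·)`: the increments of
the star sums of the Hoffman dual `k^∨`. -/
def kawashimaCoeff (k : Index) (n : ℕ) : ℝ :=
  starSum (hoffmanDual k) (n + 1) - starSum (hoffmanDual k) n

/-- The Newton series `y ↦ -∑ₙ multichoose (-y) (n + 1) * kawashimaCoeff k n`, which turns out to
be the Kawashima function `F(k; y)`; the convention for `k = ∅` is that of `kawashimaF`. -/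
def kawashimaNewton (k : Index) (y : ℝ) : ℝ := if k = [] then 1 else newton (kawashimaCoeff k) y

theorem exists_hoffmanDual_eq_concat {k : Index} (hk : k ≠ []) :
    ∃ v c, hoffmanDual k = v ++ [c] :=
  (List.eq_nil_or_concat' _).resolve_left (hoffmanDual_ne_nil hk)

theorem kawashimaCoeff_eq {k v : Index} {c : ℕ+} (h : hoffmanDual k = v ++ [c]) (n : ℕ) :
    kawashimaCoeff k n = (1 / ((n : ℝ) + 1)) ^ (c : ℕ) * starSum v (n + 1) := by
  rw [kawashimaCoeff, h, starSum_concat_succ, add_sub_cancel_left]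

theorem logO_starSum_succ (v : Index) : LogO 0 fun n => starSum v (n + 1) :=
  LogO.multiset_sum (star v) fun l _ => (logO_hurwitzSum 0 l).comp_succ.comp_succ

theorem logO_one_div_succ_pow_mul_starSum (v : Index) (c : ℕ+) :
    LogO 1 fun n => (1 / ((n : ℝ) + 1)) ^ (c : ℕ) * starSum v (n + 1) :=
  (((logO_one_div_add 1).pow c).mul (logO_starSum_succ v)).mono (by simp [Nat.one_le_iff_ne_zero])

theorem logO_kawashimaCoeff {k : Index} (hk : k ≠ []) : LogO 1 (kawashimaCoeff k) := by
  obtain ⟨v, c, h⟩ := exists_hoffmanDual_eq_concat hk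
  simpa only [← kawashimaCoeff_eq h] using logO_one_div_succ_pow_mul_starSum v c

theorem succ_mul_kawashimaCoeff_singleton_one (n : ℕ) :
    ((n : ℝ) + 1) * kawashimaCoeff [1] n =
      ∑ i ∈ Finset.range (n + 1), (Pi.single 0 1 : ℕ → ℝ) i := by
  rw [kawashimaCoeff_eq (v := []) (c := 1) hoffmanDual_singleton_one, Finset.sum_range_succ']
  simpa using mul_inv_cancel₀ n.cast_add_one_ne_zero

theorem succ_mul_kawashimaCoeff_concat_one {k : Index} (hk : k ≠ []) (n : ℕ) :
    ((n : ℝ) + 1) * kawashimaCoeff (k ++ [1]) n = kawashimaCoeff k n := by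
  obtain ⟨v, c, h⟩ := exists_hoffmanDual_eq_concat hk
  have h' : hoffmanDual (k ++ [1]) = v ++ [1 + c] := by
    rw [hoffmanDual_concat_one hk, h, addLast_concat]
  rw [kawashimaCoeff_eq h, kawashimaCoeff_eq h', PNat.add_coe, pow_add, PNat.one_coe, pow_one]
  field_simp

theorem succ_mul_kawashimaCoeff_concat_one_add (k : Index) (c : ℕ+) (n : ℕ) :
    ((n : ℝ) + 1) * kawashimaCoeff (k ++ [1 + c]) n =
      ∑ i ∈ Finset.range (n + 1), kawashimaCoeff (k ++ [c]) i := by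
  rw [kawashimaCoeff_eq (hoffmanDual_concat_one_add k c), PNat.one_coe, pow_one]
  simp only [kawashimaCoeff, Finset.sum_range_sub (starSum (hoffmanDual (k ++ [c])))]
  rw [starSum_zero (hoffmanDual_ne_nil (by simp)), sub_zero]
  field_simp

theorem totallyMonotone_single_zero : TotallyMonotone (Pi.single 0 1) := by
  have hbdiff : ∀ N, bdiff (Pi.single 0 1) N = Pi.single 0 1 := by
    intro N
    induction N with
    | zero => rfl
    | succ N ih =>
      funext p
      simp [bdiff_succ, ih]
  have hnonneg : (0 : ℕ → ℝ) ≤ Pi.single 0 1 := Pi.single_nonneg.mpr zero_le_one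
  exact fun N p => (hnonneg p).trans_eq (congrFun (hbdiff N) p).symm

theorem totallyMonotone_kawashimaCoeff (k : Index) (hk : k ≠ []) :
    TotallyMonotone (kawashimaCoeff k) := by
  induction k using List.reverseRecOn with
  | nil => exact absurd rfl hk
  | append_singleton k c ih =>
    induction c with
    | one =>
      obtain rfl | h := eq_or_ne k []
      · exact totallyMonotone_single_zero.of_average succ_mul_kawashimaCoeff_singleton_one
      · exact (ih h).of_succ_mul (succ_mul_kawashimaCoeff_concat_one h)
    | succ c ihc =>
      rw [add_comm c 1]
      exact (ihc (by simp)).of_average (succ_mul_kawashimaCoeff_concat_one_add k c)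

theorem kawashimaNewton_nil (y : ℝ) : kawashimaNewton [] y = 1 := if_pos rfl

theorem kawashimaNewton_of_ne_nil {k : Index} (hk : k ≠ []) :
    kawashimaNewton k = newton (kawashimaCoeff k) := funext fun _ => if_neg hk

theorem mul_newtonDiff_kawashimaCoeff_singleton_one {y : ℝ} (hy : 0 < y) :
    y * newtonDiff (kawashimaCoeff [1]) y = 1 := by
  have hsingle : LogO 1 (Pi.single 0 1 : ℕ → ℝ) := (LogO.zero 1).congr' <| by
    filter_upwards [eventually_ne_atTop 0] with n hn
    rw [Pi.single_eq_of_ne hn]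
  rw [mul_newtonDiff_of_average hsingle (logO_kawashimaCoeff (by simp))
    succ_mul_kawashimaCoeff_singleton_one hy, newtonDiff,
    tsum_eq_single 0 fun n hn => by rw [Pi.single_eq_of_ne hn, mul_zero]]
  simp

theorem pow_mul_newtonDiff_kawashimaCoeff (k : Index) (c : ℕ+) {y : ℝ} (hy : 0 < y) :
    y ^ (c : ℕ) * newtonDiff (kawashimaCoeff (k ++ [c])) y = kawashimaNewton k y := by
  induction c with
  | one =>
    rw [PNat.one_coe, pow_one]
    obtain rfl | h := eq_or_ne k []
    · exact (mul_newtonDiff_kawashimaCoeff_singleton_one hy).trans (kawashimaNewton_nil y).symm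
    · rw [mul_newtonDiff_of_succ_mul (succ_mul_kawashimaCoeff_concat_one h),
        kawashimaNewton_of_ne_nil h]
  | succ c ih =>
    rw [← ih, add_comm c 1, PNat.add_coe, add_comm, PNat.one_coe, pow_succ, mul_assoc,
      mul_newtonDiff_of_average (logO_kawashimaCoeff (by simp)) (logO_kawashimaCoeff (by simp))
        (succ_mul_kawashimaCoeff_concat_one_add k c) hy]

theorem kawashimaNewton_concat (k : Index) (c : ℕ+) {y : ℝ} (hy : 0 < y) :
    kawashimaNewton (k ++ [c]) y =
      kawashimaNewton (k ++ [c]) (y - 1) + (1 / y) ^ (c : ℕ) * kawashimaNewton k y := by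
  rw [kawashimaNewton_of_ne_nil (by simp), ← pow_mul_newtonDiff_kawashimaCoeff k c hy,
    ← mul_assoc, ← mul_pow, one_div_mul_cancel hy.ne', one_pow, one_mul, ← sub_eq_iff_eq_add']
  exact newton_sub_newton (logO_kawashimaCoeff (by simp)) hy

theorem kawashimaNewton_natCast (k : Index) (n : ℕ) : kawashimaNewton k n = starSum k n := by
  induction k using List.reverseRecOn generalizing n with
  | nil => rw [kawashimaNewton_nil, starSum_nil]
  | append_singleton k c ih =>
    induction n with
    | zero =>
      rw [starSum_zero (by simp), kawashimaNewton_of_ne_nil (by simp), Nat.cast_zero, newton_zero]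
    | succ n ihn =>
      rw [kawashimaNewton_concat k c (by positivity), ih, starSum_concat_succ, ← ihn,
        Nat.cast_succ, add_sub_cancel_right]

theorem logO_kawashimaNewton_sub_starSum (k : Index) {x : ℝ} (hx : -1 < x) :
    LogO 1 fun N : ℕ => kawashimaNewton k (x + (N + 1 : ℕ)) - starSum k (N + 1) := by
  obtain rfl | ⟨v, c, rfl⟩ := List.eq_nil_or_concat' k
  · simpa only [kawashimaNewton_nil, starSum_nil, sub_self] using LogO.zero 1
  · have hk : v ++ [c] ≠ [] := by simp
    have hshift := newton_add_succ_sub_isBigO (totallyMonotone_kawashimaCoeff _ hk)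
      (logO_kawashimaCoeff hk) hx
    simp only [← kawashimaNewton_of_ne_nil hk, kawashimaNewton_natCast, starSum_concat_succ,
      add_sub_cancel_left] at hshift
    simpa only [starSum_concat_succ] using
      (logO_one_div_succ_pow_mul_starSum v c).of_isBigO hshift

theorem sum_neg_one_pow_mul_mul_congr {R : Type*} [CommRing R] {r : ℕ} {a a' b b' w : ℕ → R}
    (ha0 : a' 0 = a 0) (ha : ∀ j < r, a' (j + 1) = a (j + 1) + w j * a' j)
    (hbr : b' r = b r) (hb : ∀ j < r, b' j = b j + w j * b (j + 1)) :
    ∑ j ∈ Finset.range (r + 1), (-1) ^ (r - j) * a' j * b' j =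
      ∑ j ∈ Finset.range (r + 1), (-1) ^ (r - j) * a j * b j := by
  have hsign : ∀ j < r, (-1 : R) ^ (r - j) = -(-1) ^ (r - (j + 1)) := fun j hj => by
    rw [show r - j = r - (j + 1) + 1 by omega, pow_succ, mul_neg_one]
  have hleft : ∑ j ∈ Finset.range (r + 1), (-1) ^ (r - j) * a' j * b' j =
      ∑ j ∈ Finset.range (r + 1), (-1) ^ (r - j) * a' j * b j -
        ∑ j ∈ Finset.range r, (-1) ^ (r - (j + 1)) * (w j * a' j) * b (j + 1) := by
    rw [Finset.sum_range_succ, Finset.sum_range_succ, hbr, add_sub_right_comm,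
      ← Finset.sum_sub_distrib]
    congr 1
    refine Finset.sum_congr rfl fun j hj => ?_
    have hj := Finset.mem_range.mp hj
    rw [hb j hj, hsign j hj]
    ring
  rw [hleft, Finset.sum_range_succ', Finset.sum_range_succ' (fun j => _ * a j * b j), ha0,
    add_sub_right_comm, ← Finset.sum_sub_distrib]
  congr 1
  refine Finset.sum_congr rfl fun j hj => ?_
  rw [ha j (Finset.mem_range.mp hj)]
  ring

theorem kawashimaNewton_eq_sum (k : Index) {x : ℝ} (hx : -1 < x) (N : ℕ) :
    kawashimaNewton k x = ∑ j ∈ Finset.range (k.length + 1), (-1) ^ (k.length - j) *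
      kawashimaNewton (k.take j) (x + N) * hurwitzSum x (k.drop j).reverse (N + 1) := by
  induction N with
  | zero =>
    rw [Finset.sum_range_succ, Finset.sum_eq_zero]
    · simp [hurwitzSum_nil]
    · intro j hj
      rw [zero_add, hurwitzSum_one_of_ne_nil, mul_zero]
      simpa using Finset.mem_range.mp hj
  | succ N ih =>
    have hpos : 0 < x + (N + 1 : ℕ) := by
      push_cast
      linarith [N.cast_nonneg (α := ℝ)]
    rw [ih]
    refine (sum_neg_one_pow_mul_mul_congr
      (w := fun j => (1 / (x + (N + 1 : ℕ))) ^ (k.getD j 1 : ℕ)) ?_ ?_ ?_ ?_).symm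
    · simp only [List.take_zero, kawashimaNewton_nil]
    · intro j hj
      rw [← List.take_concat_get' k j hj, kawashimaNewton_concat _ _ hpos, Nat.cast_succ,
        ← add_assoc, add_sub_cancel_right, List.getD_eq_getElem _ _ hj]
    · simp only [List.drop_length, List.reverse_nil, hurwitzSum_nil]
    · intro j hj
      rw [List.drop_eq_getElem_cons hj, List.reverse_cons, hurwitzSum_concat_succ,
        List.getD_eq_getElem _ _ hj, Nat.cast_succ, add_comm x]

/-! ### Multiple zeta values -/

theorem injective_coe_strictMono (r : ℕ) :
    Function.Injective fun (m : {m : Fin r → ℕ+ // StrictMono m}) i => (m.1 i : ℕ) :=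
  fun _ _ h => Subtype.ext (funext fun i => PNat.coe_injective (congrFun h i))

/-- The tuples `0 < m₁ < ⋯ < m_r < N` of positive integers, where `r` is the depth of `l`; they
exhaust the summation range of the multiple zeta value `ζ(l)` as `N → ∞`. -/
def tuplesBelow (l : Index) (N : ℕ) : Finset {m : Fin l.length → ℕ+ // StrictMono m} :=
  (strictMonoTuples l.length (Finset.Ioo 0 N)).preimage (fun m i => (m.1 i : ℕ))
    (injective_coe_strictMono l.length).injOn

theorem mem_tuplesBelow {l : Index} {N : ℕ} {m : {m : Fin l.length → ℕ+ // StrictMono m}} :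
    m ∈ tuplesBelow l N ↔ ∀ i, (m.1 i : ℕ) < N := by
  rw [tuplesBelow, Finset.mem_preimage, mem_strictMonoTuples]
  exact ⟨fun h i => (Finset.mem_Ioo.mp (h.1 i)).2,
    fun h => ⟨fun i => Finset.mem_Ioo.mpr ⟨(m.1 i).pos, h i⟩, fun _ _ hij => m.2 hij⟩⟩

theorem sum_tuplesBelow (l : Index) (N : ℕ) :
    ∑ m ∈ tuplesBelow l N, mzvTerm l m = hurwitzSum 0 l N := by
  refine Eq.trans ?_ (Finset.sum_preimage _
    (strictMonoTuples l.length (Finset.Ioo 0 N)) (injective_coe_strictMono l.length).injOn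
    (fun m => ∏ i, 1 / ((m i : ℝ) + 0) ^ (l.get i : ℕ)) fun m hm hrange => ?_)
  · simp only [tuplesBelow, mzvTerm, add_zero]
  · obtain ⟨hpos, hmono⟩ := mem_strictMonoTuples.mp hm
    exact absurd ⟨⟨fun i => ⟨m i, (Finset.mem_Ioo.mp (hpos i)).1⟩, fun _ _ hij => hmono hij⟩, rfl⟩
      hrange

theorem tendsto_tuplesBelow (l : Index) : Tendsto (tuplesBelow l) atTop atTop := by
  refine tendsto_atTop_finset_of_monotone (fun M N h m hm => ?_) fun m => ?_
  · exact mem_tuplesBelow.mpr fun i => (mem_tuplesBelow.mp hm i).trans_le h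
  · refine ⟨∑ i, (m.1 i : ℕ) + 1, mem_tuplesBelow.mpr fun i => Nat.lt_succ_of_le ?_⟩
    exact Finset.single_le_sum (f := fun i => (m.1 i : ℕ)) (fun _ _ => Nat.zero_le _)
      (Finset.mem_univ i)

theorem mzvTerm_nonneg (l : Index) (m : {m : Fin l.length → ℕ+ // StrictMono m}) :
    0 ≤ mzvTerm l m := Finset.prod_nonneg fun _ _ => by positivity

theorem hasSum_mzvTerm {l : Index} {a : ℝ} (h : Tendsto (hurwitzSum 0 l) atTop (𝓝 a)) :
    HasSum (mzvTerm l) a := by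
  refine (tendsto_iff_tendsto_subseq_of_monotone
    (Finset.sum_mono_set_of_nonneg (mzvTerm_nonneg l)) (tendsto_tuplesBelow l)).mpr ?_
  simpa only [Function.comp_def, sum_tuplesBelow] using h

theorem summable_pow_mul_hurwitzSum (w : Index) (c : ℕ+) :
    Summable fun n : ℕ => (1 / ((n : ℝ) + 1)) ^ (1 + c : ℕ) * hurwitzSum 0 w (n + 1) :=
  ((((logO_one_div_add 1).pow (1 + c)).mul (logO_hurwitzSum 0 w).comp_succ).mono
    (by have := c.pos; omega)).summable

theorem hasSum_mzvTerm_concat (w : Index) (c : ℕ+) :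
    HasSum (mzvTerm (w ++ [1 + c]))
      (∑' n : ℕ, (1 / ((n : ℝ) + 1)) ^ (1 + c : ℕ) * hurwitzSum 0 w (n + 1)) := by
  have hpartial : ∀ N, ∑ n ∈ Finset.range N,
      (1 / ((n : ℝ) + 1)) ^ (1 + c : ℕ) * hurwitzSum 0 w (n + 1) =
        hurwitzSum 0 (w ++ [1 + c]) (N + 1) := by
    intro N
    induction N with
    | zero => rw [Finset.sum_range_zero, zero_add, hurwitzSum_one_of_ne_nil 0 (by simp)]
    | succ N ih => rw [Finset.sum_range_succ, ih, hurwitzSum_concat_succ, add_zero, PNat.add_coe,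
        PNat.one_coe]
  refine hasSum_mzvTerm ((tendsto_add_atTop_iff_nat 1).mp ?_)
  exact (summable_pow_mul_hurwitzSum w c).hasSum.tendsto_sum_nat.congr hpartial

theorem hasSum_mzv (w : Index) (c : ℕ+) :
    HasSum (fun n : ℕ => (1 / ((n : ℝ) + 1)) ^ (1 + c : ℕ) * hurwitzSum 0 w (n + 1))
      (mzv (w ++ [1 + c])) := by
  rw [mzv, (hasSum_mzvTerm_concat w c).tsum_eq]
  exact (summable_pow_mul_hurwitzSum w c).hasSum

theorem circledast_replicate (j : ℕ) (u : Index) (b : ℕ+) :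
    circledast (List.replicate (j + 1) 1) (u ++ [b]) =
      (stuffle (List.replicate j 1) u).map (· ++ [1 + b]) := by
  simp [List.replicate_succ', circledast]

theorem summable_mzvTerm_of_mem_kawashimaSum {k l : Index} {m : ℕ} (h : l ∈ kawashimaSum k m) :
    Summable (mzvTerm l) := by
  obtain ⟨v, _, hv⟩ := Multiset.mem_bind.mp h
  obtain _ | j := m
  · simp [circledast] at hv
  obtain rfl | ⟨u, b, rfl⟩ := List.eq_nil_or_concat' v
  · simp [circledast] at hv
  rw [circledast_replicate] at hv
  obtain ⟨w, _, rfl⟩ := Multiset.mem_map.mp hv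
  exact (hasSum_mzvTerm_concat w b).summable

theorem hasSum_multiset_sum {ι κ M : Type*} [AddCommMonoid M] [TopologicalSpace M]
    [ContinuousAdd M] (s : Multiset ι) {f : ι → κ → M} {a : ι → M}
    (h : ∀ i ∈ s, HasSum (f i) (a i)) :
    HasSum (fun n => (s.map fun i => f i n).sum) (s.map a).sum := by
  induction s using Multiset.induction_on with
  | empty => simp
  | cons i s ih =>
    simp only [Multiset.map_cons, Multiset.sum_cons]
    exact (h i (Multiset.mem_cons_self i s)).add
      (ih fun j hj => h j (Multiset.mem_cons_of_mem hj))

theorem hasSum_circledast {l : Index} (hl : l ≠ []) (j : ℕ) :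
    HasSum (fun n : ℕ => 1 / ((n : ℝ) + 1) * hurwitzSum 0 (List.replicate j 1) (n + 1) *
      (hurwitzSum 0 l (n + 2) - hurwitzSum 0 l (n + 1)))
      ((circledast (List.replicate (j + 1) 1) l).map mzv).sum := by
  obtain ⟨u, b, rfl⟩ := (List.eq_nil_or_concat' l).resolve_left hl
  rw [circledast_replicate, Multiset.map_map]
  refine (hasSum_multiset_sum (stuffle (List.replicate j 1) u) fun w _ =>
    hasSum_mzv w b).congr_fun fun n => ?_
  rw [Multiset.sum_map_mul_left, hurwitzSum_stuffle, hurwitzSum_concat_succ, add_sub_cancel_left,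
    add_zero]
  ring

theorem hasSum_kawashimaSum {k : Index} (hk : k ≠ []) (j : ℕ) :
    HasSum (fun n : ℕ => 1 / ((n : ℝ) + 1) * hurwitzSum 0 (List.replicate j 1) (n + 1) *
      kawashimaCoeff k n) ((kawashimaSum k (j + 1)).map mzv).sum := by
  rw [kawashimaSum, Multiset.map_bind, Multiset.sum_bind]
  refine (hasSum_multiset_sum _ fun l hl =>
    hasSum_circledast (ne_nil_of_mem_star (hoffmanDual_ne_nil hk) hl) j).congr_fun fun n => ?_
  rw [Multiset.sum_map_mul_left, Multiset.sum_map_sub]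
  rfl

/-! ### The Taylor series of the Kawashima function -/

theorem multichoose_add_one_eq_prod (w : ℝ) (n : ℕ) :
    Ring.multichoose (w + 1) n = ∏ i ∈ Finset.range n, (1 + w / ((i : ℝ) + 1)) := by
  induction n with
  | zero => simp
  | succ n ih =>
    rw [Finset.prod_range_succ, ← ih]
    field_simp
    linear_combination succ_mul_multichoose_succ (w + 1) n

theorem hasSum_neg_multichoose_succ (x : ℝ) (n : ℕ) :
    HasSum (fun j => x / ((n : ℝ) + 1) * ((-x) ^ j * hurwitzSum 0 (List.replicate j 1) (n + 1)))
      (-Ring.multichoose (-x) (n + 1)) := by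
  have hfactor : -Ring.multichoose (-x) (n + 1) =
      x / ((n : ℝ) + 1) * Ring.multichoose (-x + 1) n := by
    field_simp
    linear_combination -succ_mul_multichoose_succ_eq_mul_multichoose_add_one (-x) n
  rw [hfactor, multichoose_add_one_eq_prod]
  exact (hasSum_pow_mul_hurwitzSum_replicate_one (-x) n).mul_left _

/-- The terms of the double series obtained from the Newton series of the Kawashima function by
expanding the binomial coefficients in powers of `x`: the first index belongs to the Newton series,
the second one to the power series. -/
def kawashimaDoubleTerm (k : Index) (x : ℝ) (p : ℕ × ℕ) : ℝ :=
  x / ((p.1 : ℝ) + 1) * ((-x) ^ p.2 * hurwitzSum 0 (List.replicate p.2 1) (p.1 + 1)) *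
    kawashimaCoeff k p.1

theorem hasSum_kawashimaDoubleTerm_newton (k : Index) (x : ℝ) (n : ℕ) :
    HasSum (fun j => kawashimaDoubleTerm k x (n, j))
      (-Ring.multichoose (-x) (n + 1) * kawashimaCoeff k n) :=
  (hasSum_neg_multichoose_succ x n).mul_right _

theorem hasSum_kawashimaDoubleTerm_taylor {k : Index} (hk : k ≠ []) (x : ℝ) (j : ℕ) :
    HasSum (fun n => kawashimaDoubleTerm k x (n, j)) (kawashimaTerm k x j) := by
  rw [kawashimaTerm, mul_right_comm]
  refine ((hasSum_kawashimaSum hk j).mul_left _).congr_fun fun n => ?_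
  rw [kawashimaDoubleTerm, neg_pow x j]
  ring

theorem abs_kawashimaDoubleTerm {k : Index} (hk : k ≠ []) (x : ℝ) (p : ℕ × ℕ) :
    |kawashimaDoubleTerm k x p| = -kawashimaDoubleTerm k (-|x|) p := by
  have hcoeff : 0 ≤ kawashimaCoeff k p.1 := totallyMonotone_kawashimaCoeff k hk 0 p.1
  have hden : (0 : ℝ) ≤ p.1 + 1 := by positivity
  simp only [kawashimaDoubleTerm, abs_mul, abs_div, abs_pow, abs_neg, abs_of_nonneg hcoeff,
    abs_of_nonneg hden, abs_of_nonneg (hurwitzSum_nonneg _ _), neg_neg, neg_div, neg_mul]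

theorem summable_kawashimaDoubleTerm {k : Index} (hk : k ≠ []) {x : ℝ} (hx : |x| < 1) :
    Summable (kawashimaDoubleTerm k x) := by
  refine Summable.of_abs ((summable_prod_of_nonneg fun _ => abs_nonneg _).mpr ?_)
  simp only [abs_kawashimaDoubleTerm hk, tsum_neg,
    (hasSum_kawashimaDoubleTerm_newton k _ _).tsum_eq, neg_mul, neg_neg]
  exact ⟨fun n => (hasSum_kawashimaDoubleTerm_newton k _ n).summable.neg,
    (logO_kawashimaCoeff hk).summable_multichoose_succ_mul hx⟩

theorem hasSum_kawashimaTerm {k : Index} (hk : k ≠ []) {x : ℝ} (hx : |x| < 1) :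
    HasSum (kawashimaTerm k x) (kawashimaNewton k x) := by
  have hdouble := (summable_kawashimaDoubleTerm hk hx).hasSum
  have hnewton := hdouble.prod_fiberwise (hasSum_kawashimaDoubleTerm_newton k x)
  have htaylor := ((Equiv.prodComm ℕ ℕ).hasSum_iff.mpr hdouble).prod_fiberwise
    (hasSum_kawashimaDoubleTerm_taylor hk x)
  rwa [← hnewton.tsum_eq, tsum_congr fun n => neg_mul _ _, tsum_neg, ← newton,
    ← kawashimaNewton_of_ne_nil hk] at htaylor

theorem kawashimaF_eq_kawashimaNewton (k : Index) {x : ℝ} (hx : |x| < 1) :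
    kawashimaF k x = kawashimaNewton k x := by
  obtain rfl | hk := eq_or_ne k []
  · rw [kawashimaF, if_pos rfl, kawashimaNewton_nil]
  · rw [kawashimaF, if_neg hk, (hasSum_kawashimaTerm hk hx).tsum_eq]

/-! ### The formula -/

theorem logO_kawashimaNewton_sub_stuffleRegStar (k : Index) {x : ℝ} (hx : -1 < x) :
    LogO 1 fun N : ℕ => kawashimaNewton k (x + (N + 1 : ℕ)) -
      (stuffleRegStar k).eval (Real.log (N + 2 : ℕ) + Real.eulerMascheroniConstant) := by
  simpa only [sub_add_sub_cancel] using (logO_kawashimaNewton_sub_starSum k hx).add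
    (logO_starSum_sub_stuffleRegStar k).comp_succ

theorem logO_kawashimaNewton_mul_hurwitzSum_sub (k l : Index) {x : ℝ} (hx : -1 < x) :
    LogO 1 fun N : ℕ => kawashimaNewton k (x + (N + 1 : ℕ)) * hurwitzSum x l (N + 2) -
      (stuffleRegStar k).eval (Real.log (N + 2 : ℕ) + Real.eulerMascheroniConstant) *
        (stuffleReg x l).eval (Real.log (N + 2 : ℕ) - digamma (1 + x)) := by
  have hleft := (logO_kawashimaNewton_sub_stuffleRegStar k hx).mul
    (logO_hurwitzSum x l).comp_succ.comp_succ
  have hright := (LogO.log.add (LogO.const Real.eulerMascheroniConstant)).eval (stuffleRegStar k)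
    |>.comp_succ.comp_succ.mul (logO_hurwitzSum_sub_stuffleReg x l).comp_succ.comp_succ
  simpa only [sub_mul, mul_sub, sub_add_sub_cancel] using hleft.add hright

theorem C_kawashimaF_eq (k : Index) {x : ℝ} (hx : |x| < 1) :
    C (kawashimaF k x) = ∑ j ∈ Finset.range (k.length + 1),
      (-1 : ℝ[X]) ^ (k.length - j) * stuffleRegStar (k.take j) *
        (stuffleReg x (k.drop j).reverse).comp
          (X - C (Real.eulerMascheroniConstant + digamma (1 + x))) := by
  have hx1 : -1 < x := (abs_lt.mp hx).1
  have hu : Tendsto (fun N : ℕ => Real.log (N + 2 : ℕ) + Real.eulerMascheroniConstant)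
      atTop atTop := by
    simpa only [sub_neg_eq_add, Function.comp_def] using (tendsto_log_natCast_sub_atTop
      (-Real.eulerMascheroniConstant)).comp (tendsto_add_atTop_nat 2)
  have herror := LogO.sum (Finset.range (k.length + 1)) fun j _ =>
    (logO_kawashimaNewton_mul_hurwitzSum_sub (k.take j) (k.drop j).reverse hx1).const_mul
      ((-1) ^ (k.length - j))
  have hlim := herror.tendsto_zero.const_sub (kawashimaNewton k x)
  rw [sub_zero, ← kawashimaF_eq_kawashimaNewton k hx] at hlim
  refine (eq_C_of_tendsto_eval hu (hlim.congr fun N => ?_)).symm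
  rw [kawashimaF_eq_kawashimaNewton k hx, kawashimaNewton_eq_sum k hx1 (N + 1),
    ← Finset.sum_sub_distrib, eval_finsetSum]
  refine Finset.sum_congr rfl fun j _ => ?_
  simp only [eval_mul, eval_pow, eval_neg, eval_one, eval_comp, eval_sub, eval_X, eval_C,
    add_sub_add_right_eq_sub, add_comm Real.eulerMascheroniConstant]
  ring

end Kawashima

end

/-- The first three conjuncts say that the objects in the formula are well defined: the regularized
polynomials exist and are unique, the multiple zeta series converge, and so does the Taylor series
of the Kawashima function. The last one is the formula, an identity in `ℝ[T]`. -/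
theorem theorem3p1 (k : List ℕ+) (x : ℝ) (hx : |x| < 1) :
    (∀ l : List ℕ+, (∃! P : Polynomial ℝ, Kawashima.IsStuffleReg x l P) ∧
      (∃! P : Polynomial ℝ, Kawashima.IsStuffleReg 0 l P)) ∧
    (∀ m : ℕ, ∀ l ∈ Kawashima.kawashimaSum k m, Summable (Kawashima.mzvTerm l)) ∧
    (k ≠ [] → Summable (Kawashima.kawashimaTerm k x)) ∧
    Polynomial.C (Kawashima.kawashimaF k x) =
      ∑ j ∈ Finset.range (k.length + 1),
        (-1 : Polynomial ℝ) ^ (k.length - j) * Kawashima.stuffleRegStar (k.take j) *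
          (Kawashima.stuffleReg x (k.drop j).reverse).comp
            (Polynomial.X - Polynomial.C
              (Real.eulerMascheroniConstant + Kawashima.digamma (1 + x))) :=
  ⟨fun l => ⟨Kawashima.existsUnique_isStuffleReg x l, Kawashima.existsUnique_isStuffleReg 0 l⟩,
    fun _ _ h => Kawashima.summable_mzvTerm_of_mem_kawashimaSum h,
    fun hk => (Kawashima.hasSum_kawashimaTerm hk hx).summable,
    Kawashima.C_kawashimaF_eq k hx⟩
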